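/- Let $\mathcal H$ be an infinite-dimensional complex Hilbert space, $\mathcal B(\mathcal H)$ the algebra of bounded linear operators on $\mathcal H$ with operator norm $\|\cdot\|_\infty$, $\mathcal K(\mathcal H)$ the ideal of compact operators, and $\tau$ the canonical trace on positive operators, $\tau(x)=\sum_j (x\varphi_j,\varphi_j)\in[0,\infty]$ for any orthonormal basis $\{\varphi_j\}$. For $x\in\mathcal B(\mathcal H)$ and $t>0$ let $$\mu_t(x)=\inf\{\lambda>0:\ \tau(\{|x|>\lambda\})\le t\},$$ where $\{|x|>\lambda\}$ is the spectral projection of $|x|=(x^*x)^{1/2}$ for the interval $(\lambda,\infty)$. A non-zero linear subspace $X\subset\mathcal B(\mathcal H)$ with a Banach norm $\|\cdot\|_X$ is called fully symmetric if the conditions $x\in X$, $y\in\mathcal B(\mathcal H)$ and $\int_0^s\mu_t(y)\,dt\le\int_0^s\mu_t(x)\,dt$ for all $s>0$ imply that $y\in X$ and $\|y\|_X\le\|x\|_X$. Let $\mathcal C^1=\{x\in\mathcal K(\mathcal H): \|x\|_1=\tau(|x|)<\infty\}$. Write $T\in DS$ if $T:\mathcal B(\mathcal H)\to\mathcal B(\mathcal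 H)$ is linear, $\|T(x)\|_1\le\|x\|_1$ for all $x\in\mathcal C^1$, and $\|T(x)\|_\infty\le\|x\|_\infty$ for all $x\in\mathcal B(\mathcal H)$; put $A_n(T)(x)=\frac1{n+1}\sum_{k=0}^nT^k(x)$. Theorem. Let $X\subset\mathcal B(\mathcal H)$ be a fully symmetric space. Then the following conditions are equivalent: (i) for every $x\in X$ and every $T\in DS$ there exists $\widehat x\in X$ such that $\|A_n(T)(x)-\widehat x\|_\infty\to0$ as $n\to\infty$; (ii) $X\subset\mathcal K(\mathcal H)$. -/

import Mathlib

open scoped InnerProductSpace ENNReal Topology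

noncomputable section

namespace SymmOp

variable {H : Type*} [NormedAddCommGroup H] [InnerProductSpace ℂ H] [CompleteSpace H]

/-- The sum of the diagonal entries `⟨φ_j, x φ_j⟩`, in `[0, ∞]`, of a positive operator `x`
with respect to the orthonormal basis `φ`. -/
def traceOf {ι : Type*} (φ : HilbertBasis ι ℂ H) (x : H →L[ℂ] H) : ℝ≥0∞ :=
  ∑' j, ENNReal.ofReal (RCLike.re ⟪φ j, x (φ j)⟫_ℂ)

/-- The canonical trace `τ(x) ∈ [0, ∞]` of a positive operator `x`, computed in some orthonormal
basis of `H`; see `traceOf_eq_trace` for the independence of the basis.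
(It is only ever applied to positive operators.) -/
def trace (x : H →L[ℂ] H) : ℝ≥0∞ :=
  traceOf (exists_hilbertBasis ℂ H).choose_spec.choose x

lemma tsum_norm_sq {ι : Type*} {H : Type*} [NormedAddCommGroup H] [InnerProductSpace ℂ H]
    (φ : HilbertBasis ι ℂ H) (v : H) :
    ∑' j, ENNReal.ofReal (‖⟪φ j, v⟫_ℂ‖ ^ 2) = ENNReal.ofReal (‖v‖ ^ 2) := by
  have h := φ.hasSum_inner_mul_inner v v
  have h2 : HasSum (fun j => ‖⟪φ j, v⟫_ℂ‖ ^ 2) (‖v‖ ^ 2) := by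
    have h3 := Complex.hasSum_re h
    convert h3 using 1
    · funext j
      rw [← inner_conj_symm v (φ j), Complex.conj_mul', ← Complex.ofReal_pow, Complex.ofReal_re]
    · rw [inner_self_eq_norm_sq_to_K]
      norm_cast
  rw [← ENNReal.ofReal_tsum_of_nonneg (fun j => by positivity) h2.summable, h2.tsum_eq]

lemma traceOf_star_mul_self {ι κ : Type*} (φ : HilbertBasis ι ℂ H) (ψ : HilbertBasis κ ℂ H)
    (y : H →L[ℂ] H) :
    traceOf φ (star y * y) = ∑' k, ENNReal.ofReal (‖(star y) (ψ k)‖ ^ 2) := by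
  have h : traceOf φ (star y * y) = ∑' j, ENNReal.ofReal (‖y (φ j)‖ ^ 2) := by
    refine tsum_congr fun j => ?_
    rw [ContinuousLinearMap.star_eq_adjoint, mul_apply_eq_comp,
      ContinuousLinearMap.adjoint_inner_right, inner_self_eq_norm_sq]
  rw [h]
  simp_rw [← tsum_norm_sq ψ (y _), ← tsum_norm_sq φ (star y _)]
  rw [ENNReal.tsum_comm]
  refine tsum_congr fun k => tsum_congr fun j => ?_
  rw [ContinuousLinearMap.star_eq_adjoint, ContinuousLinearMap.adjoint_inner_right,
    norm_inner_symm]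

/-- The trace of a positive operator does not depend on the orthonormal basis. -/
theorem traceOf_eq_traceOf {ι κ : Type*} (φ : HilbertBasis ι ℂ H) (ψ : HilbertBasis κ ℂ H)
    {x : H →L[ℂ] H} (hx : 0 ≤ x) : traceOf φ x = traceOf ψ x := by
  obtain ⟨y, rfl⟩ := CStarAlgebra.nonneg_iff_eq_star_mul_self.mp hx
  rw [traceOf_star_mul_self φ ψ, traceOf_star_mul_self ψ ψ]

theorem traceOf_eq_trace {ι : Type*} (φ : HilbertBasis ι ℂ H) {x : H →L[ℂ] H} (hx : 0 ≤ x) :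
    traceOf φ x = trace x :=
  traceOf_eq_traceOf _ _ hx

/-- The spectral projection `e_l = {|x| > l}` of `|x| = (x* x)^{1/2}` for the interval `(l, ∞)`:
the support projection of the positive part `(|x| - l)₊`, that is, the orthogonal projection onto
the orthogonal complement of the kernel of `(|x| - l)₊`. -/
def spectralProj (x : H →L[ℂ] H) (l : ℝ) : H →L[ℂ] H :=
  ((cfc (fun s : ℝ => max (s - l) 0) (CFC.abs x) : H →L[ℂ] H).ker)ᗮ.starProjection

/-- The `t`-th generalized singular number
`μ_t(x) = inf {l > 0 : τ({|x| > l}) ≤ t}` (for `t > 0`). -/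
def singularNumber (x : H →L[ℂ] H) (t : ℝ) : ℝ :=
  sInf {l : ℝ | 0 < l ∧ trace (spectralProj x l) ≤ ENNReal.ofReal t}

/-- The Hardy-Littlewood-Polya preorder `y ≺≺ x`:
`∫₀ˢ μ_t(y) dt ≤ ∫₀ˢ μ_t(x) dt` for all `s > 0`. -/
def Submajorized (y x : H →L[ℂ] H) : Prop :=
  ∀ s : ℝ, 0 < s → ∫ t in (0 : ℝ)..s, singularNumber y t ≤ ∫ t in (0 : ℝ)..s, singularNumber x t

/-- `(X, N)` is a fully symmetric space: `X` is a non-zero linear subspace of `B(H)`, `N` is a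
norm on `X` for which `X` is complete, and `x ∈ X`, `y ∈ B(H)`, `y ≺≺ x` imply `y ∈ X` and
`N y ≤ N x`. The norm `N` is unrelated to the operator norm that `X` inherits from `B(H)`. -/
structure IsFullySymmetric (X : Submodule ℂ (H →L[ℂ] H)) (N : Seminorm ℂ X) : Prop where
  ne_bot : X ≠ ⊥
  eq_zero : ∀ x : X, N x = 0 → x = 0
  complete : ∀ u : ℕ → X,
    (∀ ε : ℝ, 0 < ε → ∃ M : ℕ, ∀ m ≥ M, ∀ n ≥ M, N (u m - u n) < ε) →
    ∃ x : X, Filter.Tendsto (fun n => N (u n - x)) Filter.atTop (𝓝 0)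
  submajorized : ∀ (x : X) (y : H →L[ℂ] H), Submajorized y (x : H →L[ℂ] H) →
    ∃ hy : y ∈ X, N ⟨y, hy⟩ ≤ N x

/-- `‖x‖₁ = τ(|x|) ∈ [0, ∞]`. -/
def norm1 (x : H →L[ℂ] H) : ℝ≥0∞ := trace (CFC.abs x)

variable (H) in
/-- The trace class `C¹`: the compact operators `x` with `‖x‖₁ < ∞`. -/
def traceClass : Set (H →L[ℂ] H) := {x | IsCompactOperator x ∧ norm1 x < ∞}

/-- Dunford-Schwartz operators: linear maps `T : B(H) → B(H)` that are contractions both for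
`‖·‖₁` on `C¹` and for the operator norm on `B(H)`. -/
structure IsDunfordSchwartz (T : (H →L[ℂ] H) →ₗ[ℂ] (H →L[ℂ] H)) : Prop where
  norm1_le : ∀ x ∈ traceClass H, norm1 (T x) ≤ norm1 x
  norm_le : ∀ x : H →L[ℂ] H, ‖T x‖ ≤ ‖x‖

/-- The ergodic averages `A_n(T)(x) = (1 / (n + 1)) ∑_{k = 0}^{n} T^k(x)`. -/
def average (T : (H →L[ℂ] H) →ₗ[ℂ] (H →L[ℂ] H)) (n : ℕ) (x : H →L[ℂ] H) : H →L[ℂ] H :=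
  ((n : ℂ) + 1)⁻¹ • ∑ k ∈ Finset.range (n + 1), (T ^ k) x

/-- The individual ergodic theorem for `X`: for all `x ∈ X` and all Dunford-Schwartz operators
`T`, the averages `A_n(T)(x)` converge in operator norm to an element of `X`. -/
def SatisfiesIET (X : Submodule ℂ (H →L[ℂ] H)) : Prop :=
  ∀ x ∈ X, ∀ T : (H →L[ℂ] H) →ₗ[ℂ] (H →L[ℂ] H), IsDunfordSchwartz T →
    ∃ y ∈ X, Filter.Tendsto (fun n => ‖average T n x - y‖) Filter.atTop (𝓝 0)

end SymmOp

end

/-! Suppose some `x` in `X` is not compact. Its distance to the compact operators is positive, so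
there are an orthonormal sequence `f i` and vectors `v i` of the unit ball with `|⟪f i, x (v i)⟫| ≥
δ`. Take a contraction `a` whose adjoint has eigenvectors `f i` with eigenvalues below `1` tending
to `1`, and let `T` be left multiplication by `a`. In the direction `f i` the average multiplies `x`
by a mean of powers of the eigenvalue: it tends to `0` as `n → ∞` for fixed `i`, but to `1` as `i →
∞` for fixed `n`. Hence the averages cannot converge in norm.

Conversely let `x` be compact. A Dunford-Schwartz operator is a contraction for the Hilbert-Schmidt
norm (`IsDunfordSchwartz.hsSq_le`), so the Hilbert space mean ergodic argument
(`cauchySeq_linAverage`) makes the averages of Hilbert-Schmidt operators Cauchy, also in operator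
norm. Finite rank approximation extends this to compact `x`, with a compact limit `y`.

To see that `y` lies in `X`, compare the sums `∑ (s - l)₊` over singular values. Soft thresholding
at `l` splits `x` into a trace class part and a remainder of norm at most `l`; each power of `T`
contracts both parts in their own norms, which bounds the matrix coefficients of all averages and of
`y` (`IsDunfordSchwartz.sum_norm_inner_le`). The layer cake formula turns the inequality between
these sums, for all `l > 0`, into submajorization (`submajorized_of_forall_sum_le`), and full
symmetry applies. -/

noncomputable section

namespace SymmOp

universe u

/-! ### Singular value decomposition and norm estimates -/

section SingularBasis

variable {H : Type u} [NormedAddCommGroup H] [InnerProductSpace ℂ H] [CompleteSpace H]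

lemma inner_abs_apply (x : H →L[ℂ] H) (v w : H) :
    ⟪CFC.abs x v, CFC.abs x w⟫_ℂ = ⟪x v, x w⟫_ℂ := by
  have hsa : IsSelfAdjoint (CFC.abs x) := (CFC.abs_nonneg x).isSelfAdjoint
  have h := congrArg (fun z : H →L[ℂ] H => ⟪v, z w⟫_ℂ) (CFC.abs_mul_abs x)
  simp only [ContinuousLinearMap.star_eq_adjoint, mul_apply_eq_comp,
    ContinuousLinearMap.adjoint_inner_right] at h
  rw [← h, ← ContinuousLinearMap.adjoint_inner_right, ← ContinuousLinearMap.star_eq_adjoint,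
    hsa.star_eq]

lemma norm_abs_apply (x : H →L[ℂ] H) (v : H) : ‖CFC.abs x v‖ = ‖x v‖ := by
  have h := inner_abs_apply x v v
  simp only [inner_self_eq_norm_sq_to_K] at h
  have h2 : ‖CFC.abs x v‖ ^ 2 = ‖x v‖ ^ 2 := by exact_mod_cast h
  exact (sq_eq_sq₀ (norm_nonneg _) (norm_nonneg _)).mp h2

omit [CompleteSpace H] in
lemma re_inner_nonneg {b : H →L[ℂ] H} (hb : 0 ≤ b) (v : H) : 0 ≤ RCLike.re ⟪v, b v⟫_ℂ :=
  ((ContinuousLinearMap.nonneg_iff_isPositive b).mp hb).re_inner_nonneg_right v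

/-- A Hilbert basis consisting of eigenvectors of `|x|`. -/
def IsSingularBasis {ι : Type*} (φ : HilbertBasis ι ℂ H) (x : H →L[ℂ] H) : Prop :=
  ∀ i, CFC.abs x (φ i) = (‖x (φ i)‖ : ℂ) • φ i

variable {ι : Type*} {φ : HilbertBasis ι ℂ H} {x : H →L[ℂ] H}

/-- The operators `x` and `|x|` give the same inner products of images. This orthogonality stands in
for the polar decomposition throughout. -/
lemma IsSingularBasis.inner_eq_zero (h : IsSingularBasis φ x) {i j : ι} (hij : i ≠ j) :
    ⟪x (φ i), x (φ j)⟫_ℂ = 0 := by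
  rw [← inner_abs_apply, h i, h j, inner_smul_left, inner_smul_right, φ.orthonormal.2 hij]
  simp

/-- An eigenvector of `b²` for `s²` is an eigenvector of the positive operator `b` for `s`. -/
lemma apply_eq_smul_of_sq {b : H →L[ℂ] H} (hb : 0 ≤ b) {s : ℝ} (hs : 0 ≤ s) {v : H}
    (h : b (b v) = ((s ^ 2 : ℝ) : ℂ) • v) : b v = (s : ℂ) • v := by
  have hsa : ContinuousLinearMap.adjoint b = b := hb.isSelfAdjoint.star_eq
  rcases hs.eq_or_lt with rfl | hs
  · have h1 : ⟪b v, b v⟫_ℂ = 0 := by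
      rw [← ContinuousLinearMap.adjoint_inner_left, hsa, h]; simp
    simpa using inner_self_eq_zero.mp h1
  -- Since `(b + s)(b - s) v = 0`, the vector `w` satisfies `b w = -s w`, which positivity of `b`
  -- allows only for `w = 0`.
  · set w := b v - (s : ℂ) • v with hw
    have h1 : b w = -((s : ℂ) • w) := by
      rw [hw, map_sub, h, map_smul, smul_sub, smul_smul]
      push_cast
      rw [sq]; abel
    have h2 := re_inner_nonneg hb w
    rw [h1, inner_neg_right, inner_smul_right, inner_self_eq_norm_sq_to_K] at h2
    have h3 : RCLike.re (-((s : ℂ) * ((‖w‖ : ℂ) ^ 2))) = -(s * ‖w‖ ^ 2) := by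
      rw [← Complex.ofReal_pow, ← Complex.ofReal_mul, ← Complex.ofReal_neg]
      exact Complex.ofReal_re _
    have h4 : 0 ≤ -(s * ‖w‖ ^ 2) := h3 ▸ h2
    have h5 : ‖w‖ ^ 2 = 0 := by nlinarith [sq_nonneg ‖w‖]
    have h6 : w = 0 := by simpa using h5
    exact sub_eq_zero.mp h6

/-- A compact self-adjoint operator has a Hilbert basis of eigenvectors. -/
lemma exists_hilbertBasis_eigenvectors {b : H →L[ℂ] H} (hc : IsCompactOperator b)
    (hb : IsSelfAdjoint b) :
    ∃ (κ : Type u) (ψ : HilbertBasis κ ℂ H) (m : κ → ℂ), ∀ i, b (ψ i) = m i • ψ i := by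
  have hsym : (b : H →ₗ[ℂ] H).IsSymmetric := hb.isSymmetric
  -- Hilbert bases of all eigenspaces are glued together, the kernel included; a `μ` that is not an
  -- eigenvalue contributes an empty basis.
  let E : ℂ → Submodule ℂ H := fun μ => Module.End.eigenspace (b : H →ₗ[ℂ] H) μ
  have hE : ∀ μ v, v ∈ E μ ↔ b v = μ • v := fun μ v => Module.End.mem_eigenspace_iff
  have hcl : ∀ μ, IsClosed (E μ : Set H) := by
    intro μ
    have : (E μ : Set H) = {v | b v = μ • v} := by ext v; exact hE μ v
    rw [this]
    exact isClosed_eq b.continuous (continuous_const_smul μ)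
  have hcomp : ∀ μ, CompleteSpace (E μ) := fun μ => (hcl μ).completeSpace_coe
  have hW : ∀ μ, ∃ (w : Set (E μ)) (β : HilbertBasis w ℂ (E μ)), True := fun μ => by
    obtain ⟨w, β, -⟩ := exists_hilbertBasis ℂ (E μ)
    exact ⟨w, β, trivial⟩
  choose W β _ using hW
  have hfam : OrthogonalFamily ℂ (fun μ => E μ) fun μ => (E μ).subtypeₗᵢ :=
    hsym.orthogonalFamily_eigenspaces
  have hon : Orthonormal ℂ fun a : Σ μ, W μ => (E a.1).subtypeₗᵢ (β a.1 a.2) :=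
    hfam.orthonormal_sigma_orthonormal fun μ => (β μ).orthonormal
  have hbot : (⨆ μ, E μ)ᗮ = ⊥ :=
    ContinuousLinearMap.orthogonalComplement_iSup_eigenspaces_eq_bot hc hsym
  have hsp : (Submodule.span ℂ (Set.range fun a : Σ μ, W μ =>
      (E a.1).subtypeₗᵢ (β a.1 a.2)))ᗮ = ⊥ := by
    rw [eq_bot_iff, ← hbot]
    intro v hv
    rw [Submodule.mem_orthogonal] at hv ⊢
    intro w hw
    have hle : (⨆ μ, E μ) ≤ (ℂ ∙ v)ᗮ := by
      refine iSup_le fun μ y hy => ?_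
      rw [Submodule.mem_orthogonal_singleton_iff_inner_left]
      have h1 := (β μ).hasSum_repr ⟨y, hy⟩
      have h2 := ((innerSL ℂ v).comp (E μ).subtypeL).hasSum h1
      have h3 : ⟪v, y⟫_ℂ = 0 := by
        refine h2.unique ?_
        convert hasSum_zero with a
        simp only [ContinuousLinearMap.comp_apply, map_smul, smul_eq_mul, mul_eq_zero]
        right
        have := hv _ (Submodule.subset_span ⟨⟨μ, a⟩, rfl⟩)
        exact inner_eq_zero_symm.mp this
      rw [inner_eq_zero_symm]; exact h3
    exact (Submodule.mem_orthogonal_singleton_iff_inner_left).mp (hle hw)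
  refine ⟨Σ μ, W μ, HilbertBasis.mkOfOrthogonalEqBot hon hsp, fun a => a.1, fun a => ?_⟩
  rw [HilbertBasis.coe_mkOfOrthogonalEqBot]
  exact (hE _ _).mp (β a.1 a.2).2

/-- Eigenvectors of the compact operator `x* x = |x|²` are eigenvectors of its positive square root,
and the eigenvalue of `x* x` at `ψ i` is `‖x (ψ i)‖²`. -/
theorem exists_isSingularBasis {x : H →L[ℂ] H} (hx : IsCompactOperator x) :
    ∃ (κ : Type u) (ψ : HilbertBasis κ ℂ H), IsSingularBasis ψ x := by
  have hc : IsCompactOperator (star x * x : H →L[ℂ] H) :=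
    IsCompactOperator.clm_comp hx (star x)
  obtain ⟨κ, ψ, m, hm⟩ := exists_hilbertBasis_eigenvectors hc (IsSelfAdjoint.star_mul_self x)
  refine ⟨κ, ψ, fun i => apply_eq_smul_of_sq (CFC.abs_nonneg x) (norm_nonneg _) ?_⟩
  have h1 : CFC.abs x (CFC.abs x (ψ i)) = m i • ψ i := by
    rw [← hm i, ← CFC.abs_mul_abs]; rfl
  have h2 : m i = ((‖x (ψ i)‖ ^ 2 : ℝ) : ℂ) := by
    have h3 : ⟪ψ i, (star x * x : H →L[ℂ] H) (ψ i)⟫_ℂ = m i := by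
      rw [hm i, inner_smul_right, inner_self_eq_norm_sq_to_K, ψ.orthonormal.1 i]; simp
    rw [← h3, ContinuousLinearMap.star_eq_adjoint, mul_apply_eq_comp,
      ContinuousLinearMap.adjoint_inner_right, inner_self_eq_norm_sq_to_K]
    norm_cast
  rw [h1, h2]

/-- The singular values of a compact operator accumulate only at zero. -/
lemma IsSingularBasis.finite_setOf_lt (h : IsSingularBasis φ x) (hx : IsCompactOperator x)
    {ε : ℝ} (hε : 0 < ε) : {i | ε < ‖x (φ i)‖}.Finite := by
  by_contra hinf
  have hinf : {i | ε < ‖x (φ i)‖}.Infinite := hinf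
  -- Infinitely many such `i` would give orthogonal vectors `x (φ i)` of norm above `ε` in a compact
  -- set; a convergent subsequence contradicts Pythagoras.
  obtain ⟨K, hK, hsub⟩ := hx.image_closedBall_subset_compact (f := (x : H →ₗ[ℂ] H)) 1
  let f := hinf.natEmbedding
  have hmem : ∀ n, x (φ (f n)) ∈ K := fun n => hsub ⟨φ (f n), by
    simp [φ.orthonormal.1], rfl⟩
  obtain ⟨y, -, g, hg, hlim⟩ := hK.tendsto_subseq hmem
  obtain ⟨N, hN⟩ := Metric.cauchySeq_iff'.mp hlim.cauchySeq ε hε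
  have h1 := hN (N + 1) (Nat.le_succ N)
  have hne : ((f (g (N + 1)) : {i | ε < ‖x (φ i)‖}) : ι) ≠ f (g N) := by
    intro heq
    have := hg.injective (f.injective (Subtype.ext heq))
    omega
  have h2 := h.inner_eq_zero hne
  have h3 := norm_sub_sq (𝕜 := ℂ) (x (φ (f (g (N + 1))))) (x (φ (f (g N))))
  rw [h2] at h3
  simp only [Function.comp_apply, dist_eq_norm] at h1
  have h4 : ε < ‖x (φ (f (g N)))‖ := (f (g N)).2
  simp only [map_zero, mul_zero, sub_zero] at h3
  nlinarith [norm_nonneg (x (φ (f (g (N + 1)))) - x (φ (f (g N)))), sq_nonneg ‖x (φ (f (g (N + 1))))‖]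

omit [CompleteSpace H] in
lemma norm_sum_sq_of_orthogonal {κ : Type*} {w : κ → H}
    (hw : ∀ i j, i ≠ j → ⟪w i, w j⟫_ℂ = 0) (F : Finset κ) :
    ‖∑ i ∈ F, w i‖ ^ 2 = ∑ i ∈ F, ‖w i‖ ^ 2 := by
  classical
  induction F using Finset.induction_on with
  | empty => simp
  | insert a F ha ih =>
    rw [Finset.sum_insert ha, Finset.sum_insert ha, norm_add_sq (𝕜 := ℂ), inner_sum, ih,
      Finset.sum_eq_zero fun i hi => hw a i fun h => ha (h ▸ hi)]
    simp

omit [CompleteSpace H] in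
-- Finite expansions in `φ` converge to `v`, and Bessel's inequality bounds their coefficients by
-- `‖v‖`.
lemma opNorm_le_of_forall_sum {z : H →L[ℂ] H} {l : ℝ} (hl : 0 ≤ l)
    (hz : ∀ (F : Finset ι) (r : ι → ℂ),
      ‖∑ i ∈ F, r i • z (φ i)‖ ^ 2 ≤ l ^ 2 * ∑ i ∈ F, ‖r i‖ ^ 2) : ‖z‖ ≤ l := by
  refine z.opNorm_le_bound hl fun v => ?_
  have h1 : Filter.Tendsto (fun F : Finset ι => ‖∑ i ∈ F, φ.repr v i • z (φ i)‖ ^ 2)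
      Filter.atTop (𝓝 (‖z v‖ ^ 2)) := by
    have h := z.hasSum (φ.hasSum_repr v)
    simp only [map_smul] at h
    exact (h.norm).pow 2
  have h2 : ‖z v‖ ^ 2 ≤ l ^ 2 * ‖v‖ ^ 2 := by
    refine le_of_tendsto h1 (Filter.Eventually.of_forall fun F => (hz F _).trans ?_)
    refine mul_le_mul_of_nonneg_left ?_ (sq_nonneg l)
    simp only [φ.repr_apply_apply]
    exact φ.orthonormal.sum_inner_products_le v
  rw [← mul_pow] at h2
  exact (sq_le_sq₀ (norm_nonneg _) (by positivity)).mp h2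

omit [CompleteSpace H] in
/-- A diagonal modification of an operator with orthogonal images is bounded by the largest
diagonal entry. -/
lemma norm_le_of_apply_eq_smul (hx : ∀ i j, i ≠ j → ⟪x (φ i), x (φ j)⟫_ℂ = 0)
    {z : H →L[ℂ] H} {c : ι → ℂ} (hz : ∀ i, z (φ i) = c i • x (φ i)) {l : ℝ} (hl : 0 ≤ l)
    (hc : ∀ i, ‖c i‖ * ‖x (φ i)‖ ≤ l) : ‖z‖ ≤ l := by
  refine opNorm_le_of_forall_sum (φ := φ) hl fun F r => ?_
  rw [norm_sum_sq_of_orthogonal (w := fun i => r i • z (φ i)), Finset.mul_sum]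
  · refine Finset.sum_le_sum fun i _ => ?_
    rw [norm_smul, hz, norm_smul, mul_pow, mul_comm]
    exact mul_le_mul_of_nonneg_right (pow_le_pow_left₀ (by positivity) (hc i) 2) (by positivity)
  · intro i j hij
    simp only [hz, inner_smul_left, inner_smul_right, hx i j hij, mul_zero]

omit [CompleteSpace H] in
/-- The operator norm is dominated by the Hilbert-Schmidt norm. -/
lemma norm_le_of_forall_sum_sq_le {z : H →L[ℂ] H} {l : ℝ} (hl : 0 ≤ l)
    (hz : ∀ F : Finset ι, ∑ i ∈ F, ‖z (φ i)‖ ^ 2 ≤ l ^ 2) : ‖z‖ ≤ l := by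
  refine opNorm_le_of_forall_sum (φ := φ) hl fun F r => ?_
  calc ‖∑ i ∈ F, r i • z (φ i)‖ ^ 2 ≤ (∑ i ∈ F, ‖r i‖ * ‖z (φ i)‖) ^ 2 := by
        refine pow_le_pow_left₀ (norm_nonneg _) ((norm_sum_le _ _).trans_eq ?_) 2
        exact Finset.sum_congr rfl fun i _ => norm_smul _ _
    _ ≤ (∑ i ∈ F, ‖r i‖ ^ 2) * ∑ i ∈ F, ‖z (φ i)‖ ^ 2 := Finset.sum_mul_sq_le_sq_mul_sq _ _ _
    _ ≤ l ^ 2 * ∑ i ∈ F, ‖r i‖ ^ 2 := by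
        rw [mul_comm]
        exact mul_le_mul_of_nonneg_right (hz F) (Finset.sum_nonneg fun _ _ => by positivity)

omit [CompleteSpace H] in
lemma isCompactOperator_rankOne (u v : H) :
    IsCompactOperator (InnerProductSpace.rankOne ℂ u v) :=
  IsCompactOperator.clm_comp (f := innerSL ℂ v)
    (isCompactOperator_of_locallyCompactSpace_dom (innerSL ℂ v))
    (ContinuousLinearMap.toSpanSingleton ℂ u)

omit [CompleteSpace H] in
lemma isCompactOperator_sum {κ : Type*} (F : Finset κ) (w : κ → H →L[ℂ] H)
    (hw : ∀ i ∈ F, IsCompactOperator (w i)) :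
    IsCompactOperator (∑ i ∈ F, w i : H →L[ℂ] H) :=
  (compactOperator (RingHom.id ℂ) H H).sum_mem hw

lemma isCompactOperator_of_approx {y : H →L[ℂ] H}
    (h : ∀ ε : ℝ, 0 < ε → ∃ z : H →L[ℂ] H, IsCompactOperator z ∧ ‖y - z‖ ≤ ε) :
    IsCompactOperator y := by
  have hcl : IsClosed {f : H →L[ℂ] H | IsCompactOperator f} :=
    isClosed_setOfPred_isCompactOperator
  refine hcl.closure_subset_iff.mpr (le_refl _) (Metric.mem_closure_iff.mpr fun ε hε => ?_)
  obtain ⟨z, hz, hzy⟩ := h (ε / 2) (by positivity)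
  exact ⟨z, hz, by rw [dist_eq_norm]; linarith⟩

/-- Keeping finitely many columns gives a finite rank operator; the error is at most the square root
of the tail of the series. -/
lemma isCompactOperator_of_summable {y : H →L[ℂ] H}
    (h : Summable fun i => ‖y (φ i)‖ ^ 2) : IsCompactOperator y := by
  classical
  refine isCompactOperator_of_approx fun ε hε => ?_
  obtain ⟨F, hF⟩ := ((tendsto_order.mp h.hasSum).1 _
    (sub_lt_self _ (by positivity : 0 < ε ^ 2))).exists
  refine ⟨∑ i ∈ F, InnerProductSpace.rankOne ℂ (y (φ i)) (φ i),
    isCompactOperator_sum _ _ fun i _ => isCompactOperator_rankOne _ _, ?_⟩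
  refine norm_le_of_forall_sum_sq_le (φ := φ) hε.le fun G => ?_
  have h1 : ∀ i, (y - ∑ i ∈ F, InnerProductSpace.rankOne ℂ (y (φ i)) (φ i)) (φ i) =
      if i ∈ F then 0 else y (φ i) := by
    intro i
    simp only [sub_apply, sum_apply,
      InnerProductSpace.rankOne_apply, orthonormal_iff_ite.mp φ.orthonormal, ite_smul, one_smul,
      zero_smul, Finset.sum_ite_eq']
    split_ifs <;> simp
  have h2 : ∑ i ∈ G, ‖(y - ∑ i ∈ F, InnerProductSpace.rankOne ℂ (y (φ i)) (φ i)) (φ i)‖ ^ 2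
      = ∑ i ∈ G \ F, ‖y (φ i)‖ ^ 2 := by
    rw [Finset.sdiff_eq_filter, Finset.sum_filter]
    refine Finset.sum_congr rfl fun i _ => ?_
    rw [h1]
    split_ifs <;> simp
  rw [h2]
  have h3 := h.sum_le_tsum (G \ F ∪ F) fun i _ => by positivity
  rw [Finset.sum_union Finset.sdiff_disjoint] at h3
  linarith

end SingularBasis

/-! ### Trace norm and trace duality -/

section TraceNorm

variable {H : Type u} [NormedAddCommGroup H] [InnerProductSpace ℂ H] [CompleteSpace H]
variable {ι : Type*} {φ : HilbertBasis ι ℂ H} {x : H →L[ℂ] H}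

lemma norm1_eq_traceOf (φ : HilbertBasis ι ℂ H) (x : H →L[ℂ] H) :
    norm1 x = ∑' i, ENNReal.ofReal (RCLike.re ⟪φ i, CFC.abs x (φ i)⟫_ℂ) :=
  (traceOf_eq_trace φ (CFC.abs_nonneg x)).symm

lemma IsSingularBasis.norm1_eq (h : IsSingularBasis φ x) :
    norm1 x = ∑' i, ENNReal.ofReal ‖x (φ i)‖ := by
  rw [norm1_eq_traceOf φ]
  refine tsum_congr fun i => ?_
  rw [h i, inner_smul_right, inner_self_eq_norm_sq_to_K, φ.orthonormal.1 i]
  simp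

/-- Cauchy-Schwarz applied to `⟪φ i, |x| (φ i)⟫`. In a singular basis this is an equality. -/
lemma norm1_le_tsum (φ : HilbertBasis ι ℂ H) (x : H →L[ℂ] H) :
    norm1 x ≤ ∑' i, ENNReal.ofReal ‖x (φ i)‖ := by
  rw [norm1_eq_traceOf φ]
  refine ENNReal.tsum_le_tsum fun i => ENNReal.ofReal_le_ofReal ?_
  refine (RCLike.re_le_norm _).trans ((norm_inner_le_norm _ _).trans_eq ?_)
  rw [φ.orthonormal.1, one_mul, norm_abs_apply]

/-- The square root `c` of `|x|` is Hilbert-Schmidt, because `‖c v‖² = ⟪v, |x| v⟫`, and then so is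
`x`. Thus a bound on `norm1 (T z)` alone puts `T z` in the trace class, and Dunford-Schwartz
operators can be iterated. -/
lemma isCompactOperator_of_norm1_lt_top (hx : norm1 x < ∞) : IsCompactOperator x := by
  obtain ⟨w, φ, -⟩ := exists_hilbertBasis ℂ H
  obtain ⟨c, hc0, hc⟩ : ∃ c : H →L[ℂ] H, 0 ≤ c ∧ c * c = CFC.abs x :=
    ⟨CFC.sqrt (CFC.abs x), CFC.sqrt_nonneg _, CFC.sqrt_mul_sqrt_self _ (CFC.abs_nonneg x)⟩
  have hcsa : ContinuousLinearMap.adjoint c = c := hc0.isSelfAdjoint.star_eq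
  have h1 : ∀ v, RCLike.re ⟪v, CFC.abs x v⟫_ℂ = ‖c v‖ ^ 2 := by
    intro v
    rw [← hc, mul_apply_eq_comp, ← ContinuousLinearMap.adjoint_inner_left, hcsa,
      inner_self_eq_norm_sq]
  have h2 : Summable fun i => ‖c (φ i)‖ ^ 2 := by
    rw [norm1_eq_traceOf φ] at hx
    simp only [h1] at hx
    have h3 := ENNReal.summable_toReal hx.ne
    refine h3.congr fun i => ENNReal.toReal_ofReal (by positivity)
  refine isCompactOperator_of_summable (φ := φ) ?_
  refine Summable.of_nonneg_of_le (fun i => by positivity) (fun i => ?_) (h2.mul_left (‖c‖ ^ 2))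
  rw [← norm_abs_apply, ← hc, mul_apply_eq_comp, ← mul_pow]
  exact pow_le_pow_left₀ (norm_nonneg _) (c.le_opNorm _) 2

lemma norm1_lt_top_iff : norm1 x < ∞ ↔ x ∈ traceClass H :=
  ⟨fun h => ⟨isCompactOperator_of_norm1_lt_top h, h⟩, fun h => h.2⟩

lemma norm1_rankOne_le (u : H) (φ : HilbertBasis ι ℂ H) (k : ι) :
    norm1 (InnerProductSpace.rankOne ℂ u (φ k)) ≤ ENNReal.ofReal ‖u‖ := by
  classical
  refine (norm1_le_tsum φ _).trans_eq ?_
  rw [tsum_eq_single k]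
  · simp [inner_self_eq_norm_sq_to_K, φ.orthonormal.1 k]
  · intro i hi
    simp [φ.orthonormal.2 hi.symm]

/-- In a singular basis of `z` the trace norm is exactly the sum of the column norms, and `a`
shrinks every column. -/
lemma norm1_mul_le (a z : H →L[ℂ] H) (ha : ‖a‖ ≤ 1) (hz : IsCompactOperator z) :
    norm1 (a * z) ≤ norm1 z := by
  obtain ⟨κ, ψ, hψ⟩ := exists_isSingularBasis hz
  rw [hψ.norm1_eq]
  refine (norm1_le_tsum ψ _).trans (ENNReal.tsum_le_tsum fun i => ENNReal.ofReal_le_ofReal ?_)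
  exact (a.le_opNorm _).trans (mul_le_of_le_one_left (norm_nonneg _) ha)

/-- Trace duality: the sum of the matrix coefficients with respect to two orthonormal families is
dominated by the trace norm. -/
lemma sum_norm_inner_le_norm1 (hx : x ∈ traceClass H) {κ : Type*} {g h : κ → H}
    (hg : Orthonormal ℂ g) (hh : Orthonormal ℂ h) (G : Finset κ) :
    ∑ l ∈ G, ‖⟪g l, x (h l)⟫_ℂ‖ ≤ (norm1 x).toReal := by
  obtain ⟨ι, φ, hφ⟩ := exists_isSingularBasis hx.1
  have hfin := hx.2
  rw [hφ.norm1_eq] at hfin ⊢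
  have hs : Summable fun i => ‖x (φ i)‖ :=
    (ENNReal.summable_toReal hfin.ne).congr fun i => ENNReal.toReal_ofReal (norm_nonneg _)
  have hts : (∑' i, ENNReal.ofReal ‖x (φ i)‖).toReal = ∑' i, ‖x (φ i)‖ := by
    rw [← ENNReal.ofReal_tsum_of_nonneg (fun i => norm_nonneg _) hs, ENNReal.toReal_ofReal]
    exact tsum_nonneg fun i => norm_nonneg _
  rw [hts]
  have h1 : ∀ l, HasSum (fun i => ⟪φ i, h l⟫_ℂ * ⟪g l, x (φ i)⟫_ℂ) ⟪g l, x (h l)⟫_ℂ := by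
    intro l
    have := ((innerSL ℂ (g l)).comp x).hasSum (φ.hasSum_repr (h l))
    simpa only [ContinuousLinearMap.comp_apply, map_smul, smul_eq_mul, φ.repr_apply_apply,
      innerSL_apply_apply] using this
  have h2 : Filter.Tendsto (fun F : Finset ι =>
      ∑ l ∈ G, ‖∑ i ∈ F, ⟪φ i, h l⟫_ℂ * ⟪g l, x (φ i)⟫_ℂ‖) Filter.atTop
      (𝓝 (∑ l ∈ G, ‖⟪g l, x (h l)⟫_ℂ‖)) :=
    tendsto_finsetSum _ fun l _ => (h1 l).norm
  refine le_of_tendsto h2 (Filter.Eventually.of_forall fun F => ?_)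
  calc ∑ l ∈ G, ‖∑ i ∈ F, ⟪φ i, h l⟫_ℂ * ⟪g l, x (φ i)⟫_ℂ‖
      ≤ ∑ l ∈ G, ∑ i ∈ F, ‖⟪h l, φ i⟫_ℂ‖ * ‖⟪g l, x (φ i)⟫_ℂ‖ := by
        refine Finset.sum_le_sum fun l _ => (norm_sum_le _ _).trans_eq ?_
        refine Finset.sum_congr rfl fun i _ => ?_
        rw [norm_mul, norm_inner_symm]
    _ = ∑ i ∈ F, ∑ l ∈ G, ‖⟪h l, φ i⟫_ℂ‖ * ‖⟪g l, x (φ i)⟫_ℂ‖ := Finset.sum_comm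
    _ ≤ ∑ i ∈ F, ‖x (φ i)‖ := by
        -- For fixed `i`, Cauchy-Schwarz over `G` followed by Bessel for `h` at `φ i` and for `g` at
        -- `x (φ i)`.
        refine Finset.sum_le_sum fun i _ => ?_
        have h3 := Finset.sum_mul_sq_le_sq_mul_sq G (fun l => ‖⟪h l, φ i⟫_ℂ‖)
          fun l => ‖⟪g l, x (φ i)⟫_ℂ‖
        have h4 := hh.sum_inner_products_le (φ i) (s := G)
        have h5 := hg.sum_inner_products_le (x (φ i)) (s := G)
        rw [φ.orthonormal.1 i, one_pow] at h4
        refine le_of_sq_le_sq (h3.trans ?_) (norm_nonneg _)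
        calc _ ≤ 1 * ‖x (φ i)‖ ^ 2 := mul_le_mul h4 h5 (by positivity) zero_le_one
          _ = _ := one_mul _
    _ ≤ ∑' i, ‖x (φ i)‖ := hs.sum_le_tsum F fun i _ => norm_nonneg _

end TraceNorm

/-! ### A non-compact operator violates the ergodic theorem -/

section Noncompact

variable {H : Type u} [NormedAddCommGroup H] [InnerProductSpace ℂ H] [CompleteSpace H]

/-- If `K` is the span of the vectors chosen so far, its projection composed with `x` is compact, so
`x` minus it still has norm above `δ`. An almost norming `v` gives `w ⟂ K` with `⟪w, x v⟫ = ‖w‖²`,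
and the next vector is `w / ‖w‖`. -/
lemma exists_orthonormal_seq_of_not_isCompactOperator {x : H →L[ℂ] H}
    (hx : ¬ IsCompactOperator x) :
    ∃ δ : ℝ, 0 < δ ∧ ∃ f v : ℕ → H, Orthonormal ℂ f ∧ (∀ j, ‖v j‖ ≤ 1) ∧
      ∀ j, δ ≤ ‖⟪f j, x (v j)⟫_ℂ‖ := by
  have h1 := mt isCompactOperator_of_approx hx
  push Not at h1
  obtain ⟨δ, hδ, h1⟩ := h1
  have h2 : ∀ s : Finset (H × H), ∃ y : H × H,
      (‖y.1‖ = 1 ∧ ‖y.2‖ ≤ 1 ∧ δ ≤ ‖⟪y.1, x y.2⟫_ℂ‖) ∧ ∀ p ∈ s, ⟪p.1, y.1⟫_ℂ = 0 := by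
    classical
    intro s
    let K : Submodule ℂ H := Submodule.span ℂ (s.image Prod.fst : Finset H)
    have hK : FiniteDimensional ℂ K := FiniteDimensional.span_finset ℂ _
    have hc : IsCompactOperator (K.starProjection.comp x) :=
      (IsCompactOperator.clm_comp (f := K.orthogonalProjectionOnto)
        (isCompactOperator_of_locallyCompactSpace_dom _) K.subtypeL).comp_clm x
    obtain ⟨v, hv, hlt⟩ := ContinuousLinearMap.exists_lt_apply_of_lt_opNorm _ (h1 _ hc)
    set w := (x - K.starProjection.comp x) v with hw
    have hw' : w = x v - K.starProjection (x v) := rfl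
    have hwpos : 0 < ‖w‖ := hδ.trans hlt
    have hwK : w ∈ Kᗮ := K.sub_starProjection_mem_orthogonal (x v)
    have hin : ⟪w, x v⟫_ℂ = (‖w‖ : ℂ) ^ 2 := by
      have : x v = w + K.starProjection (x v) := by rw [hw']; abel
      rw [this, inner_add_right, inner_self_eq_norm_sq_to_K,
        Submodule.inner_left_of_mem_orthogonal (K.starProjection_apply_mem (x v)) hwK]
      simp
    refine ⟨((‖w‖ : ℂ)⁻¹ • w, v), ⟨?_, hv.le, ?_⟩, fun p hp => ?_⟩
    · rw [norm_smul, norm_inv, Complex.norm_real, norm_norm, inv_mul_cancel₀ hwpos.ne']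
    · rw [inner_smul_left, hin, norm_mul, RCLike.norm_conj, norm_inv, norm_pow,
        Complex.norm_real, norm_norm, sq, inv_mul_cancel_left₀ hwpos.ne']
      exact hlt.le
    · rw [inner_smul_right, Submodule.inner_right_of_mem_orthogonal (Submodule.subset_span
        (by simpa using ⟨p.2, hp⟩)) hwK, mul_zero]
  obtain ⟨q, hq, hr⟩ := exists_seq_of_forall_finset_exists
    (fun y : H × H => ‖y.1‖ = 1 ∧ ‖y.2‖ ≤ 1 ∧ δ ≤ ‖⟪y.1, x y.2⟫_ℂ‖)
    (fun p y => ⟪p.1, y.1⟫_ℂ = 0) fun s _ => h2 s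
  refine ⟨δ, hδ, fun n => (q n).1, fun n => (q n).2, ⟨fun n => (hq n).1, fun m n hmn => ?_⟩,
    fun n => (hq n).2.1, fun n => (hq n).2.2⟩
  rcases lt_or_gt_of_ne hmn with h | h
  · exact hr m n h
  · exact inner_eq_zero_symm.mp (hr n m h)

omit [CompleteSpace H] in
lemma inner_starProjection_orthogonal_singleton {f : ℕ → H} (hf : Orthonormal ℂ f) (i j : ℕ)
    (w : H) : ⟪f i, (ℂ ∙ f j)ᗮ.starProjection w⟫_ℂ = if j = i then 0 else ⟪f i, w⟫_ℂ := by
  rw [← Submodule.inner_starProjection_left_eq_right]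
  split_ifs with h
  · subst h
    rw [(Submodule.starProjection_apply_eq_zero_iff _).mpr
      (Submodule.le_orthogonal_orthogonal _ (Submodule.mem_span_singleton_self _)),
      inner_zero_left]
  · rw [Submodule.starProjection_eq_self_iff.mpr]
    rw [Submodule.mem_orthogonal_singleton_iff_inner_right]
    exact hf.2 h

/-- Given an orthonormal sequence `f`, there is a contraction whose adjoint has the `f j` as
eigenvectors, with eigenvalues different from `1` but accumulating at `1`. -/
lemma exists_contraction_of_orthonormal {f : ℕ → H} (hf : Orthonormal ℂ f) :
    ∃ a : H →L[ℂ] H, ‖a‖ ≤ 1 ∧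
      ∀ i w, ⟪f i, a w⟫_ℂ = ((1 - 1 / 2 / 2 ^ i : ℝ) : ℂ) * ⟪f i, w⟫_ℂ := by
  obtain ⟨Q, hQ, hQf⟩ : ∃ Q : ℕ → H →L[ℂ] H, (∀ j, ‖Q j‖ ≤ 1) ∧
      ∀ i j w, ⟪f i, Q j w⟫_ℂ = if j = i then 0 else ⟪f i, w⟫_ℂ :=
    ⟨fun j => (ℂ ∙ f j)ᗮ.starProjection, fun j => Submodule.starProjection_norm_le _,
      inner_starProjection_orthogonal_singleton hf⟩
  -- The contraction is the convex combination `∑ c j • Q j`. Since `Q i` kills `f i` while the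
  -- other `Q j` fix it, the eigenvalue at `f i` is `1 - c i`.
  obtain ⟨c, hc⟩ : ∃ c : ℕ → ℝ, ∀ i, c i = 1 / 2 / 2 ^ i := ⟨_, fun _ => rfl⟩
  have hc0 : ∀ i, 0 ≤ c i := fun i => by rw [hc]; positivity
  have hgeo : HasSum c 1 := by
    rw [funext hc]; exact hasSum_geometric_two' 1
  have hle : ∀ j : ℕ, ‖(c j : ℂ) • Q j‖ ≤ c j := fun j => by
    rw [norm_smul, Complex.norm_real, Real.norm_of_nonneg (hc0 j)]
    exact mul_le_of_le_one_right (hc0 j) (hQ j)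
  obtain ⟨a, hsum⟩ : Summable fun j : ℕ => (c j : ℂ) • Q j :=
    Summable.of_norm_bounded hgeo.summable hle
  refine ⟨a, hsum.tsum_eq ▸ tsum_of_norm_bounded hgeo hle, fun i w => ?_⟩
  have h0 : HasSum (fun j : ℕ => ((c j : ℂ) • Q j) w) (a w) :=
    hsum.mapL (ContinuousLinearMap.apply ℂ H w)
  have h1 : HasSum (fun j : ℕ => ⟪f i, ((c j : ℂ) • Q j) w⟫_ℂ) ⟪f i, a w⟫_ℂ :=
    h0.mapL (innerSL ℂ (f i))
  have h3 : HasSum (fun j : ℕ => (c j : ℂ) * ⟪f i, w⟫_ℂ) ⟪f i, w⟫_ℂ := by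
    have := (Complex.hasSum_ofReal.mpr hgeo).mul_right ⟪f i, w⟫_ℂ
    simpa using this
  have h4 := h3.sub (hasSum_ite_eq i ((c i : ℂ) * ⟪f i, w⟫_ℂ))
  have h5 : ∀ j, ⟪f i, ((c j : ℂ) • Q j) w⟫_ℂ =
      (c j : ℂ) * ⟪f i, w⟫_ℂ - if j = i then (c i : ℂ) * ⟪f i, w⟫_ℂ else 0 := by
    intro j
    rw [smul_apply, inner_smul_right, hQf]
    split_ifs with h
    · rw [h, mul_zero, sub_self]
    · rw [sub_zero]
  simp only [h5] at h1
  rw [h1.unique h4, ← hc, Complex.ofReal_sub, Complex.ofReal_one, sub_mul, one_mul]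

lemma isDunfordSchwartz_mulLeft {a : H →L[ℂ] H} (ha : ‖a‖ ≤ 1) :
    IsDunfordSchwartz (LinearMap.mulLeft ℂ a) where
  norm1_le z hz := norm1_mul_le a z ha hz.1
  norm_le z := (norm_mul_le a z).trans (mul_le_of_le_one_left (norm_nonneg _) ha)

lemma tendsto_mean_geometric_zero {c : ℝ} (hc : 0 < c) (hc1 : c ≤ 1) :
    Filter.Tendsto (fun n : ℕ => ((n : ℝ) + 1)⁻¹ * ∑ k ∈ Finset.range (n + 1), (1 - c) ^ k)
      Filter.atTop (𝓝 0) := by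
  have h1 : Filter.Tendsto (fun n : ℕ => ((n : ℝ) + 1)⁻¹ * c⁻¹) Filter.atTop (𝓝 0) := by
    have := (tendsto_one_div_add_atTop_nhds_zero_nat (𝕜 := ℝ)).mul_const c⁻¹
    simpa using this
  refine squeeze_zero (fun n => ?_) (fun n => ?_) h1
  · have : 0 ≤ 1 - c := by linarith
    positivity
  · refine mul_le_mul_of_nonneg_left ?_ (by positivity)
    rw [geom_sum_eq (by linarith), ← one_div, show (1 - c) - 1 = -c by ring, ← neg_sub, neg_div_neg_eq]
    refine div_le_div_of_nonneg_right ?_ hc.le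
    have : 0 ≤ (1 - c) ^ (n + 1) := pow_nonneg (by linarith) _
    linarith

theorem SatisfiesIET.isCompactOperator {X : Submodule ℂ (H →L[ℂ] H)} (hX : SatisfiesIET X)
    {x : H →L[ℂ] H} (hx : x ∈ X) : IsCompactOperator x := by
  by_contra hnc
  obtain ⟨δ, hδ, f, v, hf, hv, hδf⟩ := exists_orthonormal_seq_of_not_isCompactOperator hnc
  obtain ⟨a, ha, hfa⟩ := exists_contraction_of_orthonormal hf
  obtain ⟨y, -, hy⟩ := hX x hx _ (isDunfordSchwartz_mulLeft ha)
  let A : ℕ → H →L[ℂ] H := fun n => average (LinearMap.mulLeft ℂ a) n x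
  let m : ℕ → ℕ → ℝ := fun n i =>
    ((n : ℝ) + 1)⁻¹ * ∑ k ∈ Finset.range (n + 1), (1 - 1 / 2 / 2 ^ i) ^ k
  have hpow : ∀ (k i : ℕ) (w : H),
      ⟪f i, (a ^ k) w⟫_ℂ = (((1 - 1 / 2 / 2 ^ i) ^ k : ℝ) : ℂ) * ⟪f i, w⟫_ℂ := by
    intro k i w
    induction k with
    | zero => simp
    | succ k ih =>
      rw [pow_succ', mul_apply_eq_comp, hfa, ih, ← mul_assoc, ← Complex.ofReal_mul, pow_succ']
  have hA : ∀ n i w, ⟪f i, A n w⟫_ℂ = ((m n i : ℝ) : ℂ) * ⟪f i, x w⟫_ℂ := by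
    intro n i w
    simp only [A, m, average, LinearMap.pow_mulLeft, LinearMap.mulLeft_apply,
      smul_apply, sum_apply, inner_smul_right, inner_sum,
      mul_apply_eq_comp, hpow]
    push_cast
    rw [← Finset.sum_mul, mul_assoc]
  have hlim : Filter.Tendsto A Filter.atTop (𝓝 y) := tendsto_iff_norm_sub_tendsto_zero.mpr hy
  have hy0 : ∀ i w, ⟪f i, y w⟫_ℂ = 0 := by
    intro i w
    have h1 : Filter.Tendsto (fun n => ⟪f i, A n w⟫_ℂ) Filter.atTop (𝓝 ⟪f i, y w⟫_ℂ) :=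
      (((innerSL ℂ (f i)).comp (ContinuousLinearMap.apply ℂ H w)).continuous.tendsto y).comp hlim
    simp only [hA] at h1
    have h2 : (1 : ℝ) / 2 / 2 ^ i ≤ 1 := by
      rw [div_div]
      exact div_le_one_of_le₀ (by nlinarith [one_le_pow₀ (n := i) (one_le_two (α := ℝ))])
        (by positivity)
    have h3 := ((Complex.continuous_ofReal.tendsto 0).comp
      (tendsto_mean_geometric_zero (by positivity) h2)).mul_const ⟪f i, x w⟫_ℂ
    rw [Complex.ofReal_zero, zero_mul] at h3
    exact tendsto_nhds_unique h1 h3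
  -- The limit `y` has no component along any `f i`. With `n` fixed and `i → ∞`, the factor `m n i`
  -- tends to `1`, so `A n` keeps components of size nearly `δ`.
  have hge : ∀ n, δ ≤ ‖A n - y‖ := by
    intro n
    have h1 : ∀ i, |m n i| * δ ≤ ‖A n - y‖ := by
      intro i
      calc |m n i| * δ ≤ |m n i| * ‖⟪f i, x (v i)⟫_ℂ‖ :=
            mul_le_mul_of_nonneg_left (hδf i) (abs_nonneg _)
        _ = ‖⟪f i, (A n - y) (v i)⟫_ℂ‖ := by
            rw [sub_apply, inner_sub_right, hA, hy0, sub_zero, norm_mul,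
              Complex.norm_real, Real.norm_eq_abs]
        _ ≤ ‖f i‖ * ‖(A n - y) (v i)‖ := norm_inner_le_norm _ _
        _ ≤ ‖A n - y‖ := by
            rw [hf.1 i, one_mul]
            exact ((A n - y).le_opNorm _).trans (mul_le_of_le_one_right (norm_nonneg _) (hv i))
    have h2 : Filter.Tendsto (fun i : ℕ => (1 : ℝ) / 2 / 2 ^ i) Filter.atTop (𝓝 0) :=
      (hasSum_geometric_two' 1).summable.tendsto_atTop_zero
    have h3 : Filter.Tendsto (m n) Filter.atTop (𝓝 1) := by
      have := (tendsto_finsetSum (Finset.range (n + 1)) fun k _ =>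
        (h2.const_sub 1).pow k).const_mul ((n : ℝ) + 1)⁻¹
      convert this using 2
      simp only [sub_zero, one_pow, Finset.sum_const, Finset.card_range, nsmul_eq_mul, mul_one]
      push_cast
      rw [inv_mul_cancel₀ (by positivity)]
    have h4 := h3.abs.mul_const δ
    rw [abs_one, one_mul] at h4
    exact le_of_tendsto h4 (Filter.Eventually.of_forall h1)
  exact absurd (ge_of_tendsto hy (Filter.Eventually.of_forall hge)) (not_le.mpr hδ)

end Noncompact

/-! ### Dunford-Schwartz operators on singular value decompositions -/

section DunfordSchwartz

variable {H : Type u} [NormedAddCommGroup H] [InnerProductSpace ℂ H] [CompleteSpace H]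
variable {T : (H →L[ℂ] H) →ₗ[ℂ] (H →L[ℂ] H)}

lemma IsDunfordSchwartz.mem_traceClass (hT : IsDunfordSchwartz T) {x : H →L[ℂ] H}
    (hx : x ∈ traceClass H) : T x ∈ traceClass H :=
  norm1_lt_top_iff.mp ((hT.norm1_le x hx).trans_lt hx.2)

lemma IsDunfordSchwartz.pow (hT : IsDunfordSchwartz T) (k : ℕ) : IsDunfordSchwartz (T ^ k) := by
  induction k with
  | zero => exact ⟨fun x _ => le_rfl, fun x => le_rfl⟩
  | succ k ih =>
    refine ⟨fun x hx => ?_, fun x => ?_⟩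
    · rw [pow_succ, Module.End.mul_apply]
      exact (ih.norm1_le _ (hT.mem_traceClass hx)).trans (hT.norm1_le x hx)
    · rw [pow_succ, Module.End.mul_apply]
      exact (ih.norm_le _).trans (hT.norm_le x)

variable {ι : Type*} {φ : HilbertBasis ι ℂ H} {x : H →L[ℂ] H}

/-- The normalization of `x (φ k)` (zero if `x (φ k) = 0`). -/
def leftVec (φ : HilbertBasis ι ℂ H) (x : H →L[ℂ] H) (k : ι) : H :=
  (‖x (φ k)‖ : ℂ)⁻¹ • x (φ k)

/-- The rank one partial isometries of the singular value decomposition. -/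
def singularUnit (φ : HilbertBasis ι ℂ H) (x : H →L[ℂ] H) (k : ι) : H →L[ℂ] H :=
  InnerProductSpace.rankOne ℂ (leftVec φ x k) (φ k)

omit [CompleteSpace H] in
lemma norm_leftVec_le (φ : HilbertBasis ι ℂ H) (x : H →L[ℂ] H) (k : ι) : ‖leftVec φ x k‖ ≤ 1 := by
  rw [leftVec, norm_smul, norm_inv, Complex.norm_real, norm_norm]
  exact inv_mul_le_one

lemma singularUnit_mem_traceClass (φ : HilbertBasis ι ℂ H) (x : H →L[ℂ] H) (k : ι) :
    singularUnit φ x k ∈ traceClass H :=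
  ⟨isCompactOperator_rankOne _ _, (norm1_rankOne_le _ φ k).trans_lt ENNReal.ofReal_lt_top⟩

lemma norm1_singularUnit_le (φ : HilbertBasis ι ℂ H) (x : H →L[ℂ] H) (k : ι) :
    norm1 (singularUnit φ x k) ≤ 1 :=
  (norm1_rankOne_le _ φ k).trans
    (by rw [← ENNReal.ofReal_one]; exact ENNReal.ofReal_le_ofReal (norm_leftVec_le φ x k))

open scoped Classical in
omit [CompleteSpace H] in
lemma sum_smul_singularUnit_apply (F : Finset ι) (c : ι → ℂ) (i : ι) :
    (∑ k ∈ F, c k • singularUnit φ x k) (φ i) =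
      (if i ∈ F then c i * (‖x (φ i)‖ : ℂ)⁻¹ else 0) • x (φ i) := by
  simp only [sum_apply, smul_apply, singularUnit, InnerProductSpace.rankOne_apply,
    orthonormal_iff_ite.mp φ.orthonormal, ite_smul, one_smul, zero_smul, smul_ite, smul_zero,
    Finset.sum_ite_eq']
  rw [leftVec, smul_smul]

/-- The partial isometries have mutually orthogonal initial spaces and mutually orthogonal ranges,
so the largest coefficient controls the norm. -/
lemma IsSingularBasis.norm_sum_smul_le (h : IsSingularBasis φ x) (F : Finset ι) {c : ι → ℂ}
    (hc : ∀ i, ‖c i‖ ≤ 1) : ‖∑ k ∈ F, c k • singularUnit φ x k‖ ≤ 1 := by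
  classical
  refine norm_le_of_apply_eq_smul (fun i j => h.inner_eq_zero)
    (sum_smul_singularUnit_apply F c) zero_le_one fun i => ?_
  split_ifs
  · rw [norm_mul, norm_inv, Complex.norm_real, norm_norm, mul_assoc]
    exact mul_le_one₀ (hc i) (by positivity) inv_mul_le_one
  · simp

/-- Truncation of the singular value decomposition. -/
lemma IsSingularBasis.norm_sub_sum_le (h : IsSingularBasis φ x) {F : Finset ι} {c : ι → ℝ}
    {l : ℝ} (hl : 0 ≤ l) (hF : ∀ i ∈ F, |‖x (φ i)‖ - c i| ≤ l)
    (hF' : ∀ i, i ∉ F → ‖x (φ i)‖ ≤ l) :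
    ‖x - ∑ k ∈ F, (c k : ℂ) • singularUnit φ x k‖ ≤ l := by
  classical
  refine norm_le_of_apply_eq_smul (x := x) (φ := φ)
    (c := fun i => 1 - if i ∈ F then (c i : ℂ) * (‖x (φ i)‖ : ℂ)⁻¹ else 0)
    (fun i j => h.inner_eq_zero) (fun i => ?_) hl fun i => ?_
  · rw [sub_apply, sum_smul_singularUnit_apply, sub_smul, one_smul]
  · split_ifs with hi
    · rcases eq_or_ne ‖x (φ i)‖ 0 with h0 | h0
      · rw [h0, mul_zero]; exact hl
      · refine le_trans (le_of_eq ?_) (hF i hi)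
        have h1 : (1 : ℂ) - (c i : ℂ) * (‖x (φ i)‖ : ℂ)⁻¹ =
            ((1 - c i * ‖x (φ i)‖⁻¹ : ℝ) : ℂ) := by push_cast; rfl
        rw [h1, Complex.norm_real, Real.norm_eq_abs]
        conv_lhs => rw [← abs_of_nonneg (norm_nonneg (x (φ i))), ← abs_mul]
        rw [abs_of_nonneg (norm_nonneg (x (φ i))), sub_mul, one_mul, mul_assoc,
          inv_mul_cancel₀ h0, mul_one]
    · simpa using hF' i hi

/-- Unimodular phases turn the sum into one coefficient of `T` applied to a contraction. This is the
row bound of the Schur test, coming from the operator norm. -/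
lemma IsDunfordSchwartz.sum_norm_inner_singularUnit_le (hT : IsDunfordSchwartz T)
    (h : IsSingularBasis φ x) (F : Finset ι) {v w : H} (hv : ‖v‖ ≤ 1) (hw : ‖w‖ ≤ 1) :
    ∑ k ∈ F, ‖⟪v, T (singularUnit φ x k) w⟫_ℂ‖ ≤ 1 := by
  have hph : ∀ k, ∃ c : ℂ, ‖c‖ ≤ 1 ∧
      c * ⟪v, T (singularUnit φ x k) w⟫_ℂ = ‖⟪v, T (singularUnit φ x k) w⟫_ℂ‖ := by
    intro k
    set z := ⟪v, T (singularUnit φ x k) w⟫_ℂ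
    rcases eq_or_ne z 0 with h0 | h0
    · exact ⟨0, by simp, by simp [h0]⟩
    · have hz : (‖z‖ : ℂ) ≠ 0 := by exact_mod_cast norm_ne_zero_iff.mpr h0
      refine ⟨(starRingEnd ℂ) z * (‖z‖ : ℂ)⁻¹, ?_, ?_⟩
      · rw [norm_mul, RCLike.norm_conj, norm_inv, Complex.norm_real, norm_norm]
        exact mul_inv_le_one
      · rw [mul_right_comm, mul_comm ((starRingEnd ℂ) z), Complex.mul_conj', sq,
          mul_inv_cancel_right₀ hz]
  choose c hc hcz using hph
  have h1 : ((∑ k ∈ F, ‖⟪v, T (singularUnit φ x k) w⟫_ℂ‖ : ℝ) : ℂ) =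
      ⟪v, T (∑ k ∈ F, c k • singularUnit φ x k) w⟫_ℂ := by
    rw [map_sum, sum_apply, inner_sum]
    push_cast
    refine Finset.sum_congr rfl fun k _ => ?_
    rw [map_smul, smul_apply, inner_smul_right, hcz]
  have h2 : ‖⟪v, T (∑ k ∈ F, c k • singularUnit φ x k) w⟫_ℂ‖ ≤ 1 := by
    refine (norm_inner_le_norm _ _).trans (mul_le_one₀ hv (norm_nonneg _) ?_)
    refine (ContinuousLinearMap.le_opNorm _ _).trans (mul_le_one₀ ?_ (norm_nonneg _) hw)
    exact (hT.norm_le _).trans (h.norm_sum_smul_le F hc)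
  rw [← h1, Complex.norm_real] at h2
  exact (Real.le_norm_self _).trans h2

/-- The column bound of the Schur test: trace duality and contractivity in trace norm. -/
lemma IsDunfordSchwartz.sum_norm_inner_singularUnit_le' (hT : IsDunfordSchwartz T)
    (φ : HilbertBasis ι ℂ H) (x : H →L[ℂ] H) (k : ι) {κ : Type*} {g h : κ → H}
    (hg : Orthonormal ℂ g) (hh : Orthonormal ℂ h) (G : Finset κ) :
    ∑ l ∈ G, ‖⟪g l, T (singularUnit φ x k) (h l)⟫_ℂ‖ ≤ 1 := by
  have hm := singularUnit_mem_traceClass φ x k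
  refine (sum_norm_inner_le_norm1 (hT.mem_traceClass hm) hg hh G).trans ?_
  exact ENNReal.toReal_le_of_le_ofReal zero_le_one
    (by rw [ENNReal.ofReal_one]; exact (hT.norm1_le _ hm).trans (norm1_singularUnit_le φ x k))

/-- The matrix coefficients of `T x` are submajorized by the singular values of `x`. -/
lemma IsDunfordSchwartz.sum_norm_inner_le (hT : IsDunfordSchwartz T) (h : IsSingularBasis φ x)
    {F : Finset ι} {l : ℝ} (hl : 0 ≤ l) (hF : ∀ i, i ∉ F → ‖x (φ i)‖ ≤ l) {κ : Type*}
    {v w : κ → H} (hv : Orthonormal ℂ v) (hw : Orthonormal ℂ w) (G : Finset κ) :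
    ∑ j ∈ G, ‖⟪v j, T x (w j)⟫_ℂ‖ ≤ ∑ k ∈ F, max (‖x (φ k)‖ - l) 0 + G.card * l := by
  -- Soft thresholding: `a` has trace norm at most `∑ c k` and `x - a` has norm at most `l`. Trace
  -- duality handles `T a` at no cost in `G`, while `T (x - a)` costs `l` for each index in `G`.
  set c : ι → ℝ := fun k => max (‖x (φ k)‖ - l) 0 with hc
  have hc0 : ∀ k, 0 ≤ c k := fun k => le_max_right _ _
  set a := ∑ k ∈ F, (c k : ℂ) • singularUnit φ x k with ha
  have hb : ‖x - a‖ ≤ l := by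
    refine h.norm_sub_sum_le hl (fun i _ => ?_) hF
    rw [abs_le]
    rcases max_cases (‖x (φ i)‖ - l) 0 with h1 | h1 <;>
      constructor <;> simp only [hc] <;> linarith [norm_nonneg (x (φ i))]
  have hsplit : T x = T a + T (x - a) := by rw [← map_add, add_sub_cancel]
  have h1 : ∀ j, ‖⟪v j, T (x - a) (w j)⟫_ℂ‖ ≤ l := fun j => by
    refine (norm_inner_le_norm _ _).trans ?_
    rw [hv.1 j, one_mul]
    refine (ContinuousLinearMap.le_opNorm _ _).trans ?_
    rw [hw.1 j, mul_one]
    exact (hT.norm_le _).trans hb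
  have h2 : ∑ j ∈ G, ‖⟪v j, T a (w j)⟫_ℂ‖ ≤ ∑ k ∈ F, c k := by
    calc ∑ j ∈ G, ‖⟪v j, T a (w j)⟫_ℂ‖
        ≤ ∑ j ∈ G, ∑ k ∈ F, c k * ‖⟪v j, T (singularUnit φ x k) (w j)⟫_ℂ‖ := by
          refine Finset.sum_le_sum fun j _ => ?_
          rw [ha, map_sum, sum_apply, inner_sum]
          refine (norm_sum_le _ _).trans_eq (Finset.sum_congr rfl fun k _ => ?_)
          rw [map_smul, smul_apply, inner_smul_right, norm_mul, Complex.norm_real,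
            Real.norm_of_nonneg (hc0 k)]
      _ = ∑ k ∈ F, c k * ∑ j ∈ G, ‖⟪v j, T (singularUnit φ x k) (w j)⟫_ℂ‖ := by
          rw [Finset.sum_comm]
          exact Finset.sum_congr rfl fun k _ => (Finset.mul_sum _ _ _).symm
      _ ≤ ∑ k ∈ F, c k := Finset.sum_le_sum fun k _ => mul_le_of_le_one_right (hc0 k)
          (hT.sum_norm_inner_singularUnit_le' φ x k hv hw G)
  calc ∑ j ∈ G, ‖⟪v j, T x (w j)⟫_ℂ‖
      ≤ ∑ j ∈ G, (‖⟪v j, T a (w j)⟫_ℂ‖ + ‖⟪v j, T (x - a) (w j)⟫_ℂ‖) := by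
        refine Finset.sum_le_sum fun j _ => ?_
        rw [hsplit, add_apply, inner_add_right]
        exact norm_add_le _ _
    _ ≤ _ := by
        rw [Finset.sum_add_distrib]
        refine add_le_add h2 ((Finset.sum_le_card_nsmul _ _ _ fun j _ => h1 j).trans_eq ?_)
        rw [nsmul_eq_mul]

lemma IsSingularBasis.exists_finset_norm_sub_le (h : IsSingularBasis φ x)
    (hx : IsCompactOperator x) {ε : ℝ} (hε : 0 < ε) :
    ∃ F : Finset ι, ‖x - ∑ k ∈ F, (‖x (φ k)‖ : ℂ) • singularUnit φ x k‖ ≤ ε := by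
  refine ⟨(h.finite_setOf_lt hx hε).toFinset, h.norm_sub_sum_le hε.le (fun i _ => ?_)
    fun i hi => ?_⟩
  · simp [hε.le]
  · simpa using hi

/-- Finite rank truncations go to trace class operators, and `T` does not increase the truncation
error. -/
lemma IsDunfordSchwartz.isCompactOperator (hT : IsDunfordSchwartz T) (hx : IsCompactOperator x) :
    IsCompactOperator (T x) := by
  obtain ⟨κ, ψ, hψ⟩ := exists_isSingularBasis hx
  refine isCompactOperator_of_approx fun ε hε => ?_
  obtain ⟨F, hF⟩ := hψ.exists_finset_norm_sub_le hx hε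
  refine ⟨T (∑ k ∈ F, (‖x (ψ k)‖ : ℂ) • singularUnit ψ x k), ?_, ?_⟩
  · rw [map_sum]
    refine isCompactOperator_sum _ _ fun k _ => ?_
    rw [map_smul]
    exact (hT.mem_traceClass (singularUnit_mem_traceClass ψ x k)).1.smul _
  · rw [← map_sub]
    exact (hT.norm_le _).trans hF

lemma IsSingularBasis.orthonormal_leftVec (h : IsSingularBasis φ x) :
    Orthonormal ℂ fun i : {i // x (φ i) ≠ 0} => leftVec φ x i := by
  refine ⟨fun i => ?_, fun i j hij => ?_⟩
  · simp only [leftVec]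
    rw [norm_smul, norm_inv, Complex.norm_real, norm_norm,
      inv_mul_cancel₀ (norm_ne_zero_iff.mpr i.2)]
  · simp only [leftVec]
    rw [inner_smul_left, inner_smul_right,
      h.inner_eq_zero fun hc => hij (Subtype.ext hc), mul_zero, mul_zero]

omit [CompleteSpace H] in
lemma inner_leftVec_self (φ : HilbertBasis ι ℂ H) (x : H →L[ℂ] H) (i : ι) :
    ⟪leftVec φ x i, x (φ i)⟫_ℂ = (‖x (φ i)‖ : ℂ) := by
  rw [leftVec, inner_smul_left, inner_self_eq_norm_sq_to_K]
  rcases eq_or_ne (‖x (φ i)‖ : ℂ) 0 with h | h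
  · simp [h]
  · rw [map_inv₀, Complex.conj_ofReal, sq]
    exact inv_mul_cancel_left₀ h _

/-- The square of the Hilbert-Schmidt norm. -/
def hsSq (y : H →L[ℂ] H) : ℝ≥0∞ := trace (star y * y)

lemma hsSq_eq (φ : HilbertBasis ι ℂ H) (y : H →L[ℂ] H) :
    hsSq y = ∑' i, ENNReal.ofReal (‖y (φ i)‖ ^ 2) := by
  rw [hsSq, ← traceOf_eq_trace φ (star_mul_self_nonneg y)]
  refine tsum_congr fun j => ?_
  rw [ContinuousLinearMap.star_eq_adjoint, mul_apply_eq_comp,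
    ContinuousLinearMap.adjoint_inner_right, inner_self_eq_norm_sq]

lemma summable_norm_sq_iff (φ : HilbertBasis ι ℂ H) (y : H →L[ℂ] H) :
    (Summable fun i => ‖y (φ i)‖ ^ 2) ↔ hsSq y < ∞ := by
  rw [hsSq_eq φ]
  refine ⟨fun h => ?_, fun h => ?_⟩
  · rw [← ENNReal.ofReal_tsum_of_nonneg (fun i => by positivity) h]
    exact ENNReal.ofReal_lt_top
  · exact (ENNReal.summable_toReal h.ne).congr fun i => ENNReal.toReal_ofReal (by positivity)

/-- The Schur test: Dunford-Schwartz operators are contractions for the Hilbert-Schmidt norm. -/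
lemma IsDunfordSchwartz.hsSq_le (hT : IsDunfordSchwartz T) (y : H →L[ℂ] H) :
    hsSq (T y) ≤ hsSq y := by
  rcases eq_or_ne (hsSq y) ∞ with htop | htop
  · rw [htop]; exact le_top
  obtain ⟨w, φ₀, -⟩ := exists_hilbertBasis ℂ H
  have hy : IsCompactOperator y :=
    isCompactOperator_of_summable ((summable_norm_sq_iff φ₀ y).mpr htop.lt_top)
  obtain ⟨ι, φ, hφ⟩ := exists_isSingularBasis hy
  obtain ⟨κ, ψ, hψ⟩ := exists_isSingularBasis (hT.isCompactOperator hy)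
  have hsum := (summable_norm_sq_iff φ y).mpr htop.lt_top
  set r : κ → ℝ := fun j => ‖T y (ψ j)‖ with hr
  have key : ∀ G : Finset {j // T y (ψ j) ≠ 0},
      ∑ j ∈ G, r j ^ 2 ≤ ∑' k, ‖y (φ k)‖ ^ 2 := by
    intro G
    refine le_of_forall_pos_le_add fun ε hε => ?_
    -- Half of `∑ r j ^ 2` will be absorbed on the left, which doubles the error `η * ∑ r j`. The `+
    -- 1` in the witness avoids division by zero.
    obtain ⟨η, hη, hηε⟩ : ∃ η : ℝ, 0 < η ∧ 2 * (η * ∑ j ∈ G, r j) ≤ ε := by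
      have h0 : 0 ≤ ∑ j ∈ G, r j := Finset.sum_nonneg fun j _ => norm_nonneg _
      refine ⟨ε / (2 * (∑ j ∈ G, r j + 1)), by positivity, ?_⟩
      rw [div_mul_eq_mul_div, ← mul_div_assoc, div_le_iff₀ (by positivity)]
      nlinarith
    obtain ⟨F, hF⟩ := hφ.exists_finset_norm_sub_le hy hη
    set a := ∑ k ∈ F, (‖y (φ k)‖ : ℂ) • singularUnit φ y k with ha
    set M : κ → ι → ℝ := fun j k =>
      ‖⟪leftVec ψ (T y) j, T (singularUnit φ y k) (ψ j)⟫_ℂ‖ with hM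
    have hrow : ∀ j, ∑ k ∈ F, M j k ≤ 1 := fun j =>
      hT.sum_norm_inner_singularUnit_le hφ F (norm_leftVec_le _ _ _) (ψ.orthonormal.1 j).le
    have hcol : ∀ k, ∑ j ∈ G, M j k ≤ 1 := fun k =>
      hT.sum_norm_inner_singularUnit_le' φ y k hψ.orthonormal_leftVec
        (ψ.orthonormal.comp _ Subtype.val_injective) G
    have h1 : ∀ j, r j ≤ ∑ k ∈ F, ‖y (φ k)‖ * M j k + η := by
      intro j
      have h2 : (r j : ℂ) = ⟪leftVec ψ (T y) j, T a (ψ j)⟫_ℂ +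
          ⟪leftVec ψ (T y) j, T (y - a) (ψ j)⟫_ℂ := by
        rw [← inner_add_right, ← add_apply, ← map_add, add_sub_cancel, inner_leftVec_self]
      have h3 : r j = ‖(r j : ℂ)‖ := by rw [Complex.norm_real, hr, norm_norm]
      rw [h3, h2]
      refine (norm_add_le _ _).trans (add_le_add ?_ ?_)
      · rw [ha, map_sum, sum_apply, inner_sum]
        refine (norm_sum_le _ _).trans_eq (Finset.sum_congr rfl fun k _ => ?_)
        rw [map_smul, smul_apply, inner_smul_right, norm_mul, Complex.norm_real, norm_norm]
      · refine (norm_inner_le_norm _ _).trans ?_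
        refine (mul_le_of_le_one_left (norm_nonneg _) (norm_leftVec_le _ _ _)).trans ?_
        refine (ContinuousLinearMap.le_opNorm _ _).trans ?_
        rw [ψ.orthonormal.1, mul_one]
        exact (hT.norm_le _).trans hF
    -- Multiply `h1` by `r j`, use `ab ≤ a²/2 + b²/2`, then sum: row bounds treat the terms in `r
    -- j`, column bounds those in `‖y (φ k)‖`.
    have h4 : ∑ j ∈ G, r j ^ 2 ≤
        (∑ j ∈ G, r j ^ 2) / 2 + (∑ k ∈ F, ‖y (φ k)‖ ^ 2) / 2 + η * ∑ j ∈ G, r j := by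
      calc ∑ j ∈ G, r j ^ 2
          ≤ ∑ j ∈ G, (∑ k ∈ F, (r j ^ 2 / 2 + ‖y (φ k)‖ ^ 2 / 2) * M j k + η * r j) := by
            refine Finset.sum_le_sum fun j _ => ?_
            have h5 := mul_le_mul_of_nonneg_right (h1 j) (norm_nonneg (T y (ψ j)))
            rw [add_mul, Finset.sum_mul] at h5
            refine (sq (r j)).trans_le (h5.trans (add_le_add_left ?_ _))
            refine Finset.sum_le_sum fun k _ => ?_
            rw [mul_right_comm]
            refine mul_le_mul_of_nonneg_right ?_ (norm_nonneg _)
            nlinarith [sq_nonneg (‖y (φ k)‖ - ‖T y (ψ j)‖)]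
        _ = ∑ j ∈ G, r j ^ 2 / 2 * ∑ k ∈ F, M j k
              + ∑ k ∈ F, ‖y (φ k)‖ ^ 2 / 2 * ∑ j ∈ G, M j k + η * ∑ j ∈ G, r j := by
            rw [Finset.sum_add_distrib, ← Finset.mul_sum]
            simp only [add_mul, Finset.sum_add_distrib, Finset.mul_sum]
            rw [Finset.sum_comm (s := F)]
        _ ≤ _ := by
            rw [Finset.sum_div, Finset.sum_div]
            refine add_le_add_left (add_le_add ?_ ?_) _
            · exact Finset.sum_le_sum fun j _ =>
                mul_le_of_le_one_right (by positivity) (hrow j)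
            · exact Finset.sum_le_sum fun k _ =>
                mul_le_of_le_one_right (by positivity) (hcol k)
    have h6 := hsum.sum_le_tsum F fun i _ => by positivity
    linarith
  rw [hsSq_eq ψ, hsSq_eq φ, ← ENNReal.ofReal_tsum_of_nonneg (fun i => by positivity) hsum,
    ENNReal.tsum_eq_iSup_sum]
  refine iSup_le fun G => ?_
  rw [← ENNReal.ofReal_sum_of_nonneg fun i _ => by positivity]
  classical
  refine ENNReal.ofReal_le_ofReal (le_trans (le_of_eq ?_) (key (G.subtype _)))
  rw [Finset.sum_subtype_eq_sum_filter (f := fun j => r j ^ 2), Finset.sum_filter]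
  refine Finset.sum_congr rfl fun j _ => ?_
  split_ifs with h0
  · rfl
  · rw [not_not.mp h0]; simp

end DunfordSchwartz

/-! ### Mean ergodic theorem by norm minimization -/

section MeanErgodic

open Filter

variable {V E : Type*} [AddCommGroup V] [Module ℂ V] [NormedAddCommGroup E]
  [InnerProductSpace ℂ E]

/-- The ergodic averages of a linear map, as linear maps. -/
def linAverage (T : V →ₗ[ℂ] V) (n : ℕ) : V →ₗ[ℂ] V :=
  ((n : ℂ) + 1)⁻¹ • ∑ k ∈ Finset.range (n + 1), T ^ k

lemma linAverage_apply (T : V →ₗ[ℂ] V) (n : ℕ) (v : V) :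
    linAverage T n v = ((n : ℂ) + 1)⁻¹ • ∑ k ∈ Finset.range (n + 1), (T ^ k) v := by
  simp [linAverage, LinearMap.sum_apply]

lemma norm_natCast_add_one_inv (n : ℕ) : ‖((n : ℂ) + 1)⁻¹‖ = ((n : ℝ) + 1)⁻¹ := by
  rw [norm_inv]
  norm_cast

lemma norm_average_le_of_le {F : Type*} [NormedAddCommGroup F] [NormedSpace ℂ F] (n : ℕ)
    {w : ℕ → F} {C : ℝ} (hw : ∀ k, ‖w k‖ ≤ C) :
    ‖((n : ℂ) + 1)⁻¹ • ∑ k ∈ Finset.range (n + 1), w k‖ ≤ C := by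
  rw [norm_smul, norm_natCast_add_one_inv, inv_mul_le_iff₀ (by positivity)]
  refine (norm_sum_le_of_le _ fun k _ => hw k).trans_eq ?_
  simp

variable {T : V →ₗ[ℂ] V} {J : V →ₗ[ℂ] E}

lemma norm_pow_le_of_contraction (hT : ∀ v, ‖J (T v)‖ ≤ ‖J v‖) (k : ℕ) (v : V) :
    ‖J ((T ^ k) v)‖ ≤ ‖J v‖ := by
  induction k with
  | zero => simp
  | succ k ih =>
    rw [pow_succ', Module.End.mul_apply]
    exact (hT _).trans ih

lemma norm_linAverage_le (hT : ∀ v, ‖J (T v)‖ ≤ ‖J v‖) (n : ℕ) (v : V) :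
    ‖J (linAverage T n v)‖ ≤ ‖J v‖ := by
  rw [linAverage_apply, map_smul, map_sum]
  exact norm_average_le_of_le n fun k => norm_pow_le_of_contraction hT k v

lemma linAverage_sub_linAverage_apply (T : V →ₗ[ℂ] V) (n : ℕ) (v : V) :
    linAverage T n v - linAverage T n (T v) = ((n : ℂ) + 1)⁻¹ • (v - (T ^ (n + 1)) v) := by
  rw [linAverage_apply, linAverage_apply, ← smul_sub, ← Finset.sum_sub_distrib]
  congr 1
  have h := Finset.sum_range_sub' (fun k => (T ^ k) v) (n + 1)
  simpa only [pow_succ, Module.End.mul_apply, pow_zero, Module.End.one_apply] using h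

lemma tendsto_linAverage_sub_pow (hT : ∀ v, ‖J (T v)‖ ≤ ‖J v‖) (v : V) (k : ℕ) :
    Tendsto (fun n => J (linAverage T n v - linAverage T n ((T ^ k) v))) atTop (𝓝 0) := by
  induction k with
  | zero => simp
  | succ k ih =>
    have h1 : Tendsto (fun n => J (linAverage T n ((T ^ k) v)
        - linAverage T n (T ((T ^ k) v)))) atTop (𝓝 0) := by
      have h2 : Tendsto (fun n : ℕ => 1 / ((n : ℝ) + 1) * (2 * ‖J v‖)) atTop (𝓝 0) := by
        simpa using (tendsto_one_div_add_atTop_nhds_zero_nat (𝕜 := ℝ)).mul_const (2 * ‖J v‖)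
      refine squeeze_zero_norm (fun n => ?_) h2
      rw [linAverage_sub_linAverage_apply, map_smul, norm_smul, norm_natCast_add_one_inv, one_div,
        map_sub]
      refine mul_le_mul_of_nonneg_left ((norm_sub_le _ _).trans ?_) (by positivity)
      have h3 := norm_pow_le_of_contraction hT k v
      have h4 := norm_pow_le_of_contraction hT (n + 1) ((T ^ k) v)
      linarith
    have h5 := ih.add h1
    rw [add_zero] at h5
    refine h5.congr fun n => ?_
    rw [← map_add, pow_succ', Module.End.mul_apply]
    congr 1; abel

/-- The mean ergodic theorem for contractions of a (possibly incomplete) inner product space. -/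
theorem cauchySeq_linAverage (hT : ∀ v, ‖J (T v)‖ ≤ ‖J v‖) (v : V) :
    CauchySeq fun n => J (linAverage T n v) := by
  -- `C` collects the vectors whose averages are asymptotic to those of `v`, in the seminorm `‖J
  -- ·‖`. It contains the averages of `v` and is closed under midpoints, so minimizing the norm over
  -- `C` replaces the projection onto fixed vectors and needs no completeness.
  let C : Set V := {w | Tendsto (fun n => J (linAverage T n v - linAverage T n w)) atTop (𝓝 0)}
  have hpow : ∀ k, (T ^ k) v ∈ C := tendsto_linAverage_sub_pow hT v
  have havg : ∀ m, linAverage T m v ∈ C := by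
    intro m
    have h1 := (tendsto_finsetSum (Finset.range (m + 1)) fun k _ => hpow k).const_smul
      ((m : ℂ) + 1)⁻¹
    simp only [Finset.sum_const_zero, smul_zero] at h1
    refine h1.congr fun n => ?_
    have h2 : linAverage T n v - linAverage T n (linAverage T m v) = ((m : ℂ) + 1)⁻¹ •
        ∑ k ∈ Finset.range (m + 1), (linAverage T n v - linAverage T n ((T ^ k) v)) := by
      rw [linAverage_apply T m, map_smul, map_sum, Finset.sum_sub_distrib, smul_sub]
      congr 1
      rw [Finset.sum_const, Finset.card_range, ← Nat.cast_smul_eq_nsmul ℂ, smul_smul]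
      push_cast
      rw [inv_mul_cancel₀ (Nat.cast_add_one_ne_zero m), one_smul]
    rw [h2, map_smul, map_sum]
  have hmid : ∀ u ∈ C, ∀ w ∈ C, (2 : ℂ)⁻¹ • (u + w) ∈ C := by
    intro u hu w hw
    have h1 := (hu.add hw).const_smul (2 : ℂ)⁻¹
    simp only [add_zero, smul_zero] at h1
    refine h1.congr fun n => ?_
    rw [← map_add, ← map_smul]
    congr 1
    rw [map_smul, map_add]
    module
  set d := sInf ((fun w => ‖J w‖) '' C) with hd
  have hbdd : BddBelow ((fun w => ‖J w‖) '' C) := ⟨0, by rintro _ ⟨w, -, rfl⟩; exact norm_nonneg _⟩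
  have hne : ((fun w => ‖J w‖) '' C).Nonempty := ⟨_, v, by simpa using hpow 0, rfl⟩
  have hd0 : 0 ≤ d := le_csInf hne (by rintro _ ⟨w, -, rfl⟩; exact norm_nonneg _)
  have hdle : ∀ w ∈ C, d ≤ ‖J w‖ := fun w hw => csInf_le hbdd ⟨w, hw, rfl⟩
  have hlim : Tendsto (fun n => ‖J (linAverage T n v)‖) atTop (𝓝 d) := by
    refine tendsto_order.mpr ⟨fun a ha => Eventually.of_forall fun n =>
      ha.trans_le (hdle _ (havg n)), fun a ha => ?_⟩
    obtain ⟨_, ⟨w, hw, rfl⟩, hwa⟩ := exists_lt_of_csInf_lt hne ha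
    have h1 : ∀ᶠ n in atTop, ‖J (linAverage T n v - linAverage T n w)‖ < a - ‖J w‖ := by
      have := (tendsto_order.mp (hw.norm)).2 (a - ‖J w‖) (by rw [norm_zero]; exact sub_pos.mpr hwa)
      exact this
    filter_upwards [h1] with n hn
    have h2 := norm_linAverage_le hT n w
    have h3 : ‖J (linAverage T n v)‖ ≤
        ‖J (linAverage T n v - linAverage T n w)‖ + ‖J (linAverage T n w)‖ := by
      rw [map_sub]
      exact norm_le_norm_sub_add _ _
    linarith
  have hsq : Tendsto (fun n => 2 * ‖J (linAverage T n v)‖ ^ 2 - 2 * d ^ 2) atTop (𝓝 0) := by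
    have := ((hlim.pow 2).const_mul 2).sub_const (2 * d ^ 2)
    rwa [sub_self] at this
  refine Metric.cauchySeq_iff'.mpr fun ε hε => ?_
  obtain ⟨N, hN⟩ := eventually_atTop.mp ((tendsto_order.mp hsq).2 (ε ^ 2 / 2) (by positivity))
  refine ⟨N, fun n hn => ?_⟩
  rw [dist_eq_norm]
  -- The averages are a minimizing sequence in `C` and their midpoints have norm at least `d`, so
  -- the parallelogram law makes them Cauchy.
  have h1 := parallelogram_law_with_norm ℂ (J (linAverage T n v)) (J (linAverage T N v))
  have h2 := hdle _ (hmid _ (havg n) _ (havg N))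
  rw [map_smul, map_add, norm_smul, norm_inv, Complex.norm_two] at h2
  have h3 := hN n hn
  have h4 := hN N le_rfl
  have h5 : (2 * d) ^ 2 ≤ ‖J (linAverage T n v) + J (linAverage T N v)‖ ^ 2 :=
    pow_le_pow_left₀ (by positivity) (by linarith) 2
  refine lt_of_pow_lt_pow_left₀ 2 hε.le ?_
  nlinarith

end MeanErgodic

/-! ### Uniform convergence of averages of compact operators -/

section Convergence

open Filter

variable {H : Type u} [NormedAddCommGroup H] [InnerProductSpace ℂ H] [CompleteSpace H]
variable {T : (H →L[ℂ] H) →ₗ[ℂ] (H →L[ℂ] H)} {ι : Type*}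

omit [CompleteSpace H] in
lemma average_eq_linAverage (T : (H →L[ℂ] H) →ₗ[ℂ] (H →L[ℂ] H)) (n : ℕ) (x : H →L[ℂ] H) :
    average T n x = linAverage T n x := (linAverage_apply T n x).symm

lemma memℓp_two_iff (φ : HilbertBasis ι ℂ H) (y : H →L[ℂ] H) :
    Memℓp (fun i => y (φ i)) 2 ↔ hsSq y < ∞ := by
  rw [← summable_norm_sq_iff φ, memℓp_gen_iff (by norm_num)]
  norm_num

/-- The Hilbert-Schmidt operators. -/
def hilbertSchmidt (φ : HilbertBasis ι ℂ H) : Submodule ℂ (H →L[ℂ] H) where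
  carrier := {y | Memℓp (fun i => y (φ i)) 2}
  add_mem' hy hz := hy.add hz
  zero_mem' := zero_memℓp
  smul_mem' c _ hy := hy.const_smul c

/-- The columns of a Hilbert-Schmidt operator, as an element of `ℓ²`. -/
def columns (φ : HilbertBasis ι ℂ H) : hilbertSchmidt φ →ₗ[ℂ] lp (fun _ : ι => H) 2 where
  toFun y := ⟨fun i => (y : H →L[ℂ] H) (φ i), y.2⟩
  map_add' _ _ := rfl
  map_smul' _ _ := rfl

omit [CompleteSpace H] in
lemma norm_columns_sq (φ : HilbertBasis ι ℂ H) (y : hilbertSchmidt φ) :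
    ‖columns φ y‖ ^ 2 = ∑' i, ‖(y : H →L[ℂ] H) (φ i)‖ ^ 2 := by
  have h := lp.norm_rpow_eq_tsum (p := 2) (by norm_num) (columns φ y)
  simp only [ENNReal.toReal_ofNat, Real.rpow_two] at h
  exact h

lemma ofReal_norm_columns_sq (φ : HilbertBasis ι ℂ H) (y : hilbertSchmidt φ) :
    ENNReal.ofReal (‖columns φ y‖ ^ 2) = hsSq (y : H →L[ℂ] H) := by
  rw [norm_columns_sq, hsSq_eq φ, ENNReal.ofReal_tsum_of_nonneg (fun i => by positivity)]
  exact (summable_norm_sq_iff φ _).mpr ((memℓp_two_iff φ _).mp y.2)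

lemma norm_le_norm_columns (φ : HilbertBasis ι ℂ H) (y : hilbertSchmidt φ) :
    ‖(y : H →L[ℂ] H)‖ ≤ ‖columns φ y‖ := by
  refine norm_le_of_forall_sum_sq_le (φ := φ) (norm_nonneg _) fun F => ?_
  rw [norm_columns_sq]
  have h1 : Summable fun i => ‖(y : H →L[ℂ] H) (φ i)‖ ^ 2 :=
    (summable_norm_sq_iff φ _).mpr ((memℓp_two_iff φ _).mp y.2)
  exact h1.sum_le_tsum F fun i _ => by positivity

/-- The mean ergodic theorem applies to the restriction of `T` to Hilbert-Schmidt operators,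
embedded in `ℓ²` by columns; the operator norm is dominated by the `ℓ²` norm. -/
lemma IsDunfordSchwartz.cauchySeq_average_hilbertSchmidt (hT : IsDunfordSchwartz T)
    (φ : HilbertBasis ι ℂ H) {y : H →L[ℂ] H} (hy : y ∈ hilbertSchmidt φ) :
    CauchySeq fun n => average T n y := by
  have hmap : ∀ z ∈ hilbertSchmidt φ, T z ∈ hilbertSchmidt φ := fun z hz =>
    (memℓp_two_iff φ _).mpr ((hT.hsSq_le z).trans_lt ((memℓp_two_iff φ z).mp hz))
  let S : hilbertSchmidt φ →ₗ[ℂ] hilbertSchmidt φ := T.restrict hmap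
  have hS : ∀ z, ‖columns φ (S z)‖ ≤ ‖columns φ z‖ := by
    intro z
    have h1 := hT.hsSq_le (z : H →L[ℂ] H)
    have h2 : hsSq (T (z : H →L[ℂ] H)) = hsSq ((S z : hilbertSchmidt φ) : H →L[ℂ] H) := rfl
    rw [h2, ← ofReal_norm_columns_sq φ, ← ofReal_norm_columns_sq φ,
      ENNReal.ofReal_le_ofReal_iff (by positivity)] at h1
    exact (sq_le_sq₀ (norm_nonneg _) (norm_nonneg _)).mp h1
  have hpow : ∀ (k : ℕ) (z : hilbertSchmidt φ),
      (((S ^ k) z : hilbertSchmidt φ) : H →L[ℂ] H) = (T ^ k) (z : H →L[ℂ] H) := by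
    intro k z
    induction k with
    | zero => simp
    | succ k ih =>
      rw [pow_succ', pow_succ', Module.End.mul_apply, Module.End.mul_apply, ← ih]
      rfl
  have hco : ∀ n, average T n y =
      ((linAverage S n ⟨y, hy⟩ : hilbertSchmidt φ) : H →L[ℂ] H) := by
    intro n
    rw [linAverage_apply, average, Submodule.coe_smul, Submodule.coe_sum]
    simp only [hpow]
  have hc := cauchySeq_linAverage (J := columns φ) hS ⟨y, hy⟩
  rw [Metric.cauchySeq_iff'] at hc ⊢
  intro ε hε
  obtain ⟨N, hN⟩ := hc ε hε
  refine ⟨N, fun n hn => lt_of_le_of_lt ?_ (hN n hn)⟩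
  rw [dist_eq_norm, dist_eq_norm, hco, hco, ← map_sub, ← Submodule.coe_sub]
  exact norm_le_norm_columns φ _

lemma IsDunfordSchwartz.norm_average_le (hT : IsDunfordSchwartz T) (n : ℕ) (x : H →L[ℂ] H) :
    ‖average T n x‖ ≤ ‖x‖ :=
  SymmOp.norm_average_le_of_le n fun k => (hT.pow k).norm_le x

lemma rankOne_mem_hilbertSchmidt (φ : HilbertBasis ι ℂ H) (u : H) (k : ι) :
    InnerProductSpace.rankOne ℂ u (φ k) ∈ hilbertSchmidt φ := by
  classical
  refine (memℓp_two_iff φ _).mpr ((summable_norm_sq_iff φ _).mp ?_)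
  refine summable_of_ne_finset_zero (s := {k}) fun i hi => ?_
  have : k ≠ i := fun h => hi (by simp [h])
  simp [φ.orthonormal.2 this]

/-- The averages of a compact operator under a Dunford-Schwartz operator converge uniformly. -/
theorem IsDunfordSchwartz.exists_tendsto_average (hT : IsDunfordSchwartz T) {x : H →L[ℂ] H}
    (hx : IsCompactOperator x) :
    ∃ y : H →L[ℂ] H, IsCompactOperator y ∧ Tendsto (fun n => average T n x) atTop (𝓝 y) := by
  obtain ⟨ι, φ, hφ⟩ := exists_isSingularBasis hx
  have hc : CauchySeq fun n => average T n x := by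
    rw [Metric.cauchySeq_iff']
    intro ε hε
    obtain ⟨F, hF⟩ := hφ.exists_finset_norm_sub_le hx (show (0 : ℝ) < ε / 4 by positivity)
    set a := ∑ k ∈ F, (‖x (φ k)‖ : ℂ) • singularUnit φ x k with ha
    have hmem : a ∈ hilbertSchmidt φ := Submodule.sum_mem _ fun k _ =>
      Submodule.smul_mem _ _ (rankOne_mem_hilbertSchmidt φ _ k)
    obtain ⟨N, hN⟩ := Metric.cauchySeq_iff'.mp (hT.cauchySeq_average_hilbertSchmidt φ hmem)
      (ε / 2) (by positivity)
    refine ⟨N, fun n hn => ?_⟩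
    have h1 : ∀ n, ‖average T n x - average T n a‖ ≤ ε / 4 := fun n => by
      rw [average_eq_linAverage, average_eq_linAverage, ← map_sub, ← average_eq_linAverage]
      exact (hT.norm_average_le n _).trans hF
    have h2 := hN n hn
    rw [dist_eq_norm] at h2 ⊢
    have h3 : average T n x - average T N x = (average T n x - average T n a) +
        (average T n a - average T N a) - (average T N x - average T N a) := by abel
    rw [h3]
    refine (norm_sub_le _ _).trans_lt ?_
    linarith [norm_add_le (average T n x - average T n a) (average T n a - average T N a),
      h1 n, h1 N]
  obtain ⟨y, hy⟩ := cauchySeq_tendsto_of_complete hc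
  refine ⟨y, isCompactOperator_of_tendsto hy (Eventually.of_forall fun n => ?_), hy⟩
  exact (isCompactOperator_sum _ _ fun k _ => (hT.pow k).isCompactOperator hx).smul _

end Convergence

/-! ### Singular numbers, layer cake and submajorization -/

section SingularNumbers

open MeasureTheory Set

variable {H : Type u} [NormedAddCommGroup H] [InnerProductSpace ℂ H] [CompleteSpace H]
variable {ι : Type*} {φ : HilbertBasis ι ℂ H} {x : H →L[ℂ] H}

/-- The functional calculus for `s ↦ (s - l)₊` on an eigenvector. -/
lemma cfc_posPart_sub_apply {b : H →L[ℂ] H} (hb : IsSelfAdjoint b) (l : ℝ) {s : ℝ} {v : H}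
    (hv : b v = (s : ℂ) • v) :
    (cfc (fun r : ℝ => max (r - l) 0) b : H →L[ℂ] H) v = ((max (s - l) 0 : ℝ) : ℂ) • v := by
  -- Here `p` and `q` are the positive and negative parts of `b - l`, so `p q = q p = 0` and `p v -
  -- q v = (s - l) v`. Applying `p` (if `s ≤ l`) or `q` (if `s > l`) and pairing with `v` shows that
  -- this part kills `v`.
  set p : H →L[ℂ] H := cfc (fun r : ℝ => max (r - l) 0) b with hp
  set q : H →L[ℂ] H := cfc (fun r : ℝ => max (l - r) 0) b with hq
  have hp0 : 0 ≤ p := cfc_nonneg fun r _ => le_max_right _ _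
  have hq0 : 0 ≤ q := cfc_nonneg fun r _ => le_max_right _ _
  have hpq : p * q = 0 := by
    rw [hp, hq, ← cfc_mul _ _ b, ← cfc_zero ℝ b]
    refine cfc_congr fun r _ => ?_
    rcases le_total r l with h | h
    · simp [max_eq_right (sub_nonpos.mpr h)]
    · simp [max_eq_right (sub_nonpos.mpr h)]
  have hqp : q * p = 0 := by
    rw [hp, hq, ← cfc_mul _ _ b, ← cfc_zero ℝ b]
    refine cfc_congr fun r _ => ?_
    rcases le_total r l with h | h
    · simp [max_eq_right (sub_nonpos.mpr h)]
    · simp [max_eq_right (sub_nonpos.mpr h)]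
  have hsub : p - q = b - algebraMap ℝ (H →L[ℂ] H) l := by
    rw [hp, hq, ← cfc_sub _ _ b]
    conv_rhs => rw [← cfc_id' ℝ b, ← cfc_const l b, ← cfc_sub _ _ b]
    refine cfc_congr fun r _ => ?_
    rcases le_total r l with h | h
    · simp only [max_eq_right (sub_nonpos.mpr h), max_eq_left (sub_nonneg.mpr h)]; ring
    · simp only [max_eq_right (sub_nonpos.mpr h), max_eq_left (sub_nonneg.mpr h)]; ring
  have h1 : p v - q v = ((s - l : ℝ) : ℂ) • v := by
    have h2 := congrArg (fun z : H →L[ℂ] H => z v) hsub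
    simp only [sub_apply, hv] at h2
    rw [h2, Algebra.algebraMap_eq_smul_one, smul_apply, one_apply_eq_self, ← Complex.coe_smul,
      ← sub_smul, Complex.ofReal_sub]
  have hpq' : ∀ w, p (q w) = 0 := fun w => congrArg (fun z : H →L[ℂ] H => z w) hpq
  have hqp' : ∀ w, q (p w) = 0 := fun w => congrArg (fun z : H →L[ℂ] H => z w) hqp
  have hsq : ∀ c : H →L[ℂ] H, 0 ≤ c → ⟪v, c (c v)⟫_ℂ = ((‖c v‖ ^ 2 : ℝ) : ℂ) := fun c hc => by
    have hcsa : ContinuousLinearMap.adjoint c = c := hc.isSelfAdjoint.star_eq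
    rw [← ContinuousLinearMap.adjoint_inner_left, hcsa, inner_self_eq_norm_sq_to_K]
    norm_cast
  have hre : ∀ (r : ℝ) (c : H →L[ℂ] H), (⟪v, (r : ℂ) • c v⟫_ℂ).re = r * (⟪v, c v⟫_ℂ).re := by
    intro r c
    rw [inner_smul_right, Complex.re_ofReal_mul]
  rcases le_or_gt s l with h | h
  · have h2 : p (p v) = ((s - l : ℝ) : ℂ) • p v := by
      rw [← map_smul, ← h1, map_sub, hpq', sub_zero]
    have h3 := congrArg Complex.re (hsq p hp0)
    rw [h2, hre, Complex.ofReal_re] at h3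
    have h4 : 0 ≤ (⟪v, p v⟫_ℂ).re := re_inner_nonneg hp0 v
    have h5 : ‖p v‖ ^ 2 ≤ 0 := by
      rw [← h3]; exact mul_nonpos_of_nonpos_of_nonneg (by linarith) h4
    have h6 : p v = 0 := by simpa using le_antisymm h5 (sq_nonneg _)
    rw [h6, max_eq_right (by linarith)]
    simp
  · have h2 : q (q v) = ((l - s : ℝ) : ℂ) • q v := by
      have h0 : q (p v - q v) = ((s - l : ℝ) : ℂ) • q v := by rw [h1, map_smul]
      rw [map_sub, hqp', zero_sub] at h0
      rw [← neg_neg (q (q v)), h0, ← neg_smul]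
      push_cast; congr 1; ring
    have h3 := congrArg Complex.re (hsq q hq0)
    rw [h2, hre, Complex.ofReal_re] at h3
    have h4 : 0 ≤ (⟪v, q v⟫_ℂ).re := re_inner_nonneg hq0 v
    have h5 : ‖q v‖ ^ 2 ≤ 0 := by
      rw [← h3]; exact mul_nonpos_of_nonpos_of_nonneg (by linarith) h4
    have h6 : q v = 0 := by simpa using le_antisymm h5 (sq_nonneg _)
    rw [h6, sub_zero] at h1
    rw [h1, max_eq_left (by linarith)]

lemma IsSingularBasis.spectralProj_apply (h : IsSingularBasis φ x) (l : ℝ) (i : ι) :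
    spectralProj x l (φ i) = if l < ‖x (φ i)‖ then φ i else 0 := by
  have hsa : IsSelfAdjoint (CFC.abs x) := (CFC.abs_nonneg x).isSelfAdjoint
  have h1 := cfc_posPart_sub_apply hsa l (h i)
  rw [spectralProj]
  set p : H →L[ℂ] H := cfc (fun r : ℝ => max (r - l) 0) (CFC.abs x) with hp
  have hp0 : 0 ≤ p := cfc_nonneg fun r _ => le_max_right _ _
  have hpsa : ContinuousLinearMap.adjoint p = p := hp0.isSelfAdjoint.star_eq
  split_ifs with hi
  · refine Submodule.starProjection_eq_self_iff.mpr ((Submodule.mem_orthogonal _ _).mpr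
      fun w hw => ?_)
    have hw0 : p w = 0 := hw
    rw [max_eq_left (by linarith)] at h1
    have h2 : ((‖x (φ i)‖ - l : ℝ) : ℂ) * ⟪w, φ i⟫_ℂ = 0 := by
      rw [← inner_smul_right, ← h1, ← ContinuousLinearMap.adjoint_inner_left, hpsa, hw0,
        inner_zero_left]
    refine (mul_eq_zero.mp h2).resolve_left ?_
    exact_mod_cast (sub_pos.mpr hi).ne'
  · refine (Submodule.starProjection_apply_eq_zero_iff _).mpr
      (Submodule.le_orthogonal_orthogonal _ ?_)
    rw [max_eq_right (by linarith)] at h1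
    show p (φ i) = 0
    rw [h1]; simp

/-- The distribution function of the singular values. -/
def distribution (φ : HilbertBasis ι ℂ H) (x : H →L[ℂ] H) (l : ℝ) : ℝ≥0∞ :=
  ∑' i, {i | l < ‖x (φ i)‖}.indicator 1 i

lemma IsSingularBasis.trace_spectralProj (h : IsSingularBasis φ x) (l : ℝ) :
    trace (spectralProj x l) = distribution φ x l := by
  have h0 : 0 ≤ spectralProj x l := (isStarProjection_starProjection).nonneg
  rw [← traceOf_eq_trace φ h0]
  refine tsum_congr fun i => ?_
  rw [h.spectralProj_apply, Set.indicator_apply]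
  by_cases hi : l < ‖x (φ i)‖
  · rw [if_pos hi, if_pos (by exact hi), inner_self_eq_norm_sq_to_K, φ.orthonormal.1 i]
    simp
  · rw [if_neg hi, if_neg (by exact hi), inner_zero_right]
    simp

omit [CompleteSpace H] in
lemma distribution_antitone (φ : HilbertBasis ι ℂ H) (x : H →L[ℂ] H) :
    Antitone (distribution φ x) := fun _ _ hab =>
  ENNReal.tsum_le_tsum fun _ => Set.indicator_le_indicator_of_subset
    (fun _ hi => lt_of_le_of_lt hab hi) (fun _ => zero_le) _

omit [CompleteSpace H] in
lemma distribution_eq_zero (φ : HilbertBasis ι ℂ H) (x : H →L[ℂ] H) {l : ℝ} (hl : ‖x‖ ≤ l) :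
    distribution φ x l = 0 := by
  refine ENNReal.tsum_eq_zero.mpr fun i => Set.indicator_of_notMem ?_ _
  have := x.le_opNorm (φ i)
  rw [φ.orthonormal.1 i, mul_one] at this
  exact not_lt.mpr (this.trans hl)

omit [CompleteSpace H] in
lemma distribution_eq_sum {l r : ℝ} (hr : l ≤ r) {G : Finset ι}
    (hG : ∀ i, i ∈ G ↔ l < ‖x (φ i)‖) :
    distribution φ x r = ∑ i ∈ G, {i | r < ‖x (φ i)‖}.indicator 1 i :=
  tsum_eq_sum fun i hi => Set.indicator_of_notMem (s := {i | r < ‖x (φ i)‖})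
    (fun hri => hi ((hG i).mpr (hr.trans_lt hri))) _

lemma IsSingularBasis.singularNumber_eq (h : IsSingularBasis φ x) (t : ℝ) :
    singularNumber x t = sInf {l : ℝ | 0 < l ∧ distribution φ x l ≤ ENNReal.ofReal t} := by
  simp only [singularNumber, h.trace_spectralProj]

omit [CompleteSpace H] in
lemma singularNumber_set_nonempty (φ : HilbertBasis ι ℂ H) (x : H →L[ℂ] H) (t : ℝ) :
    {l : ℝ | 0 < l ∧ distribution φ x l ≤ ENNReal.ofReal t}.Nonempty :=
  ⟨‖x‖ + 1, by positivity, by rw [distribution_eq_zero φ x (by linarith)]; exact zero_le⟩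

omit [CompleteSpace H] in
lemma singularNumber_set_bddBelow (φ : HilbertBasis ι ℂ H) (x : H →L[ℂ] H) (t : ℝ) :
    BddBelow {l : ℝ | 0 < l ∧ distribution φ x l ≤ ENNReal.ofReal t} := ⟨0, fun _ hl => hl.1.le⟩

lemma IsSingularBasis.singularNumber_le (h : IsSingularBasis φ x) {l t : ℝ} (hl : 0 < l)
    (hd : distribution φ x l ≤ ENNReal.ofReal t) : singularNumber x t ≤ l := by
  rw [h.singularNumber_eq]
  exact csInf_le (singularNumber_set_bddBelow φ x t) ⟨hl, hd⟩

lemma IsSingularBasis.le_singularNumber (h : IsSingularBasis φ x) {r t : ℝ}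
    (hd : ENNReal.ofReal t < distribution φ x r) : r ≤ singularNumber x t := by
  rw [h.singularNumber_eq]
  refine le_csInf (singularNumber_set_nonempty φ x t) fun l hl => ?_
  by_contra hlr
  exact absurd (hd.trans_le (distribution_antitone φ x (not_le.mp hlr).le)) (not_lt.mpr hl.2)

lemma IsSingularBasis.distribution_le_of_singularNumber_lt (h : IsSingularBasis φ x) {l t : ℝ}
    (hlt : singularNumber x t < l) : distribution φ x l ≤ ENNReal.ofReal t := by
  rw [h.singularNumber_eq] at hlt
  obtain ⟨r, hr, hrl⟩ := exists_lt_of_csInf_lt (singularNumber_set_nonempty φ x t) hlt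
  exact (distribution_antitone φ x hrl.le).trans hr.2

lemma singularNumber_nonneg (x : H →L[ℂ] H) (t : ℝ) : 0 ≤ singularNumber x t :=
  Real.sInf_nonneg fun _ hl => hl.1.le

lemma IsSingularBasis.singularNumber_antitone (h : IsSingularBasis φ x) :
    Antitone (singularNumber x) := fun s t hst => by
  rw [h.singularNumber_eq, h.singularNumber_eq]
  exact csInf_le_csInf (singularNumber_set_bddBelow φ x t) (singularNumber_set_nonempty φ x s)
    fun l hl => ⟨hl.1, hl.2.trans (ENNReal.ofReal_le_ofReal hst)⟩

omit [CompleteSpace H] in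
-- For `r > 0` the integrand counts the `i ∈ G` with `r < ‖x (φ i)‖ - l`, so each `i` contributes
-- the length of an interval.
lemma lintegral_distribution_add {l : ℝ} {G : Finset ι} (hG : ∀ i, i ∈ G ↔ l < ‖x (φ i)‖) :
    ∫⁻ r in Ioi (0 : ℝ), distribution φ x (r + l) =
      ENNReal.ofReal (∑ i ∈ G, (‖x (φ i)‖ - l)) := by
  have h1 : ∀ r ∈ Ioi (0 : ℝ), distribution φ x (r + l) =
      ∑ i ∈ G, (Iio (‖x (φ i)‖ - l)).indicator 1 r := by
    intro r hr
    rw [distribution_eq_sum (by linarith [mem_Ioi.mp hr] : l ≤ r + l) hG]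
    refine Finset.sum_congr rfl fun i _ => ?_
    simp only [Set.indicator_apply, mem_ofPred_eq, mem_Iio, lt_sub_iff_add_lt]
    rfl
  rw [setLIntegral_congr_fun measurableSet_Ioi h1, lintegral_finsetSum _ fun i _ =>
    measurable_one.indicator measurableSet_Iio,
    ENNReal.ofReal_sum_of_nonneg fun i hi => (sub_pos.mpr ((hG i).mp hi)).le]
  refine Finset.sum_congr rfl fun i _ => ?_
  rw [lintegral_indicator_one measurableSet_Iio, Measure.restrict_apply measurableSet_Iio,
    inter_comm, Ioi_inter_Iio, Real.volume_Ioo, sub_zero]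

lemma IsSingularBasis.measurable_excess (h : IsSingularBasis φ x) (l : ℝ) :
    Measurable fun t => max (singularNumber x t - l) 0 :=
  (h.singularNumber_antitone.measurable.sub_const l).max measurable_const

lemma excess_nonneg (x : H →L[ℂ] H) (l : ℝ) (ν : Measure ℝ) :
    0 ≤ᵐ[ν] fun t => max (singularNumber x t - l) 0 :=
  Filter.Eventually.of_forall fun _ => le_max_right _ _

/-- Layer cake: within `(0, s]` the set where `μ_t - l` exceeds `r` lies in `(0, d)`, `d` being the
number of singular values above `r + l`. -/
lemma IsSingularBasis.lintegral_excess_le (h : IsSingularBasis φ x) {l : ℝ} (hl : 0 < l)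
    {G : Finset ι} (hG : ∀ i, i ∈ G ↔ l < ‖x (φ i)‖) (s : ℝ) :
    ∫⁻ t in Ioc 0 s, ENNReal.ofReal (max (singularNumber x t - l) 0) ≤
      ENNReal.ofReal (∑ i ∈ G, (‖x (φ i)‖ - l)) := by
  rw [lintegral_eq_lintegral_meas_lt _ (excess_nonneg x l _)
    (h.measurable_excess l).aemeasurable, ← lintegral_distribution_add hG]
  refine setLIntegral_mono' measurableSet_Ioi fun r hr => ?_
  rw [Measure.restrict_apply (measurableSet_lt measurable_const (h.measurable_excess l))]
  rcases eq_or_ne (distribution φ x (r + l)) ∞ with htop | htop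
  · rw [htop]; exact le_top
  have hsub : {t | r < max (singularNumber x t - l) 0} ∩ Ioc 0 s ⊆
      Ioo 0 (distribution φ x (r + l)).toReal := by
    rintro t ⟨ht, hts⟩
    refine ⟨hts.1, ?_⟩
    rw [← ENNReal.ofReal_lt_iff_lt_toReal hts.1.le htop]
    by_contra hd
    have h1 := h.singularNumber_le (by linarith [mem_Ioi.mp hr] : 0 < r + l) (not_lt.mp hd)
    have h2 : r < max (singularNumber x t - l) 0 := ht
    rcases lt_max_iff.mp h2 with h3 | h3
    · linarith
    · exact absurd h3 (not_lt.mpr (mem_Ioi.mp hr).le)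
  refine (measure_mono hsub).trans ?_
  rw [Real.volume_Ioo, sub_zero, ENNReal.ofReal_toReal htop]

lemma IsSingularBasis.le_lintegral_excess (h : IsSingularBasis φ x) {l s : ℝ}
    (hs : 0 < s) (hls : singularNumber x s < l) {G : Finset ι}
    (hG : ∀ i, i ∈ G ↔ l < ‖x (φ i)‖) :
    ENNReal.ofReal (∑ i ∈ G, (‖x (φ i)‖ - l)) ≤
      ∫⁻ t in Ioc 0 s, ENNReal.ofReal (max (singularNumber x t - l) 0) := by
  -- Non-strict superlevel sets are used because `t` below the distribution value only yields `r + l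
  -- ≤ μ_t`. The hypothesis `μ_s < l` keeps the whole interval inside `(0, s]`.
  rw [lintegral_eq_lintegral_meas_le _ (excess_nonneg x l _)
    (h.measurable_excess l).aemeasurable, ← lintegral_distribution_add hG]
  refine setLIntegral_mono' measurableSet_Ioi fun r hr => ?_
  rw [Measure.restrict_apply (measurableSet_le measurable_const (h.measurable_excess l))]
  have hd : distribution φ x (r + l) ≤ ENNReal.ofReal s :=
    h.distribution_le_of_singularNumber_lt (by linarith [mem_Ioi.mp hr])
  have htop : distribution φ x (r + l) ≠ ∞ := ne_top_of_le_ne_top ENNReal.ofReal_ne_top hd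
  have hsub : Ioo 0 (distribution φ x (r + l)).toReal ⊆
      {t | r ≤ max (singularNumber x t - l) 0} ∩ Ioc 0 s := by
    intro t ht
    have h1 := ENNReal.toReal_le_of_le_ofReal hs.le hd
    refine ⟨show r ≤ max (singularNumber x t - l) 0 from le_max_of_le_left ?_, ht.1, ht.2.le.trans h1⟩
    have h2 := h.le_singularNumber ((ENNReal.ofReal_lt_iff_lt_toReal ht.1.le htop).mpr ht.2)
    linarith
  refine le_trans (le_of_eq ?_) (measure_mono hsub)
  rw [Real.volume_Ioo, sub_zero, ENNReal.ofReal_toReal htop]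

lemma IsSingularBasis.intervalIntegrable_excess (h : IsSingularBasis φ x) (l s : ℝ) :
    IntervalIntegrable (fun t => max (singularNumber x t - l) 0) volume 0 s := by
  refine Antitone.intervalIntegrable fun a b hab => max_le_max_right 0 ?_
  linarith [h.singularNumber_antitone hab]

lemma IsSingularBasis.integral_excess (h : IsSingularBasis φ x) (l : ℝ) {s : ℝ} (hs : 0 < s) :
    ∫ t in (0 : ℝ)..s, max (singularNumber x t - l) 0 =
      (∫⁻ t in Ioc 0 s, ENNReal.ofReal (max (singularNumber x t - l) 0)).toReal := by
  rw [intervalIntegral.integral_of_le hs.le, integral_eq_lintegral_of_nonneg_ae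
    (excess_nonneg x l _)
    (h.measurable_excess l).aestronglyMeasurable]

lemma IsSingularBasis.integral_singularNumber_le (h : IsSingularBasis φ x) {l : ℝ} (hl : 0 < l)
    {G : Finset ι} (hG : ∀ i, i ∈ G ↔ l < ‖x (φ i)‖) {s : ℝ} (hs : 0 < s) :
    ∫ t in (0 : ℝ)..s, singularNumber x t ≤ ∑ i ∈ G, (‖x (φ i)‖ - l) + s * l := by
  have hint := h.intervalIntegrable_excess l s
  calc ∫ t in (0 : ℝ)..s, singularNumber x t
      ≤ ∫ t in (0 : ℝ)..s, (max (singularNumber x t - l) 0 + l) := by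
        refine intervalIntegral.integral_mono_on hs.le h.singularNumber_antitone.intervalIntegrable
          (hint.add intervalIntegrable_const) fun t _ => ?_
        linarith [le_max_left (singularNumber x t - l) 0]
    _ = (∫ t in (0 : ℝ)..s, max (singularNumber x t - l) 0) + s * l := by
        rw [intervalIntegral.integral_add hint intervalIntegrable_const,
          intervalIntegral.integral_const, sub_zero, smul_eq_mul]
    _ ≤ _ := by
        rw [h.integral_excess l hs]
        refine add_le_add_left (ENNReal.toReal_le_of_le_ofReal ?_
          (h.lintegral_excess_le hl hG s)) _
        exact Finset.sum_nonneg fun i hi => (sub_pos.mpr ((hG i).mp hi)).le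

/-- For `t ≤ s` one has `μ_t ≥ (μ_t - l)₊ + μ_s`, by monotonicity and `μ_s < l`. The gap to the
upper bound `integral_singularNumber_le` is only `s * (l - μ_s)`. -/
lemma IsSingularBasis.le_integral_singularNumber (h : IsSingularBasis φ x) {l s : ℝ}
    (hs : 0 < s) (hls : singularNumber x s < l) {G : Finset ι}
    (hG : ∀ i, i ∈ G ↔ l < ‖x (φ i)‖) :
    ∑ i ∈ G, (‖x (φ i)‖ - l) + s * singularNumber x s ≤
      ∫ t in (0 : ℝ)..s, singularNumber x t := by
  have hint := h.intervalIntegrable_excess l s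
  have hl : 0 < l := (singularNumber_nonneg x s).trans_lt hls
  calc ∑ i ∈ G, (‖x (φ i)‖ - l) + s * singularNumber x s
      ≤ (∫ t in (0 : ℝ)..s, max (singularNumber x t - l) 0) + s * singularNumber x s := by
        rw [h.integral_excess l hs]
        refine add_le_add_left ?_ _
        refine (ENNReal.ofReal_le_iff_le_toReal ?_).mp (h.le_lintegral_excess hs hls hG)
        exact ne_top_of_le_ne_top ENNReal.ofReal_ne_top (h.lintegral_excess_le hl hG s)
    _ = ∫ t in (0 : ℝ)..s, (max (singularNumber x t - l) 0 + singularNumber x s) := by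
        rw [intervalIntegral.integral_add hint intervalIntegrable_const,
          intervalIntegral.integral_const, sub_zero, smul_eq_mul]
    _ ≤ _ := by
        refine intervalIntegral.integral_mono_on hs.le (hint.add intervalIntegrable_const)
          h.singularNumber_antitone.intervalIntegrable fun t ht => ?_
        have h1 := h.singularNumber_antitone ht.2
        rcases max_cases (singularNumber x t - l) 0 with h2 | h2 <;> linarith

/-- A criterion for submajorization in terms of the truncated sums `∑ (s_i - l)₊`. -/
lemma submajorized_of_forall_sum_le {κ : Type*} {y : H →L[ℂ] H} {ψ : HilbertBasis κ ℂ H}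
    (hx : IsCompactOperator x) (hy : IsCompactOperator y) (hφ : IsSingularBasis φ x)
    (hψ : IsSingularBasis ψ y)
    (hsum : ∀ l : ℝ, 0 < l → ∀ (F : Finset ι) (G : Finset κ), (∀ i, i ∈ F ↔ l < ‖x (φ i)‖) →
      (∀ j, j ∈ G ↔ l < ‖y (ψ j)‖) →
      ∑ j ∈ G, (‖y (ψ j)‖ - l) ≤ ∑ i ∈ F, (‖x (φ i)‖ - l)) :
    Submajorized y x := by
  intro s hs
  refine le_of_forall_pos_le_add fun ε hε => ?_
  -- Strictly above `μ_s(x)`, as the lower bound for `x` requires, but so close that the gap between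
  -- the two bounds is `ε`.
  set l := singularNumber x s + ε / s with hl
  have hlt : singularNumber x s < l := by linarith [div_pos hε hs]
  have hl0 : 0 < l := (singularNumber_nonneg x s).trans_lt hlt
  have hF : ∀ i, i ∈ (hφ.finite_setOf_lt hx hl0).toFinset ↔ l < ‖x (φ i)‖ := by simp
  have hG : ∀ j, j ∈ (hψ.finite_setOf_lt hy hl0).toFinset ↔ l < ‖y (ψ j)‖ := by simp
  have h1 := hψ.integral_singularNumber_le hl0 hG hs
  have h2 := hφ.le_integral_singularNumber hs hlt hF
  have h3 := hsum l hl0 _ _ hF hG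
  have h4 : s * l = s * singularNumber x s + ε := by
    rw [hl, mul_add, mul_div_cancel₀ _ hs.ne']
  linarith

end SingularNumbers

/-! ### The limit is submajorized by the initial operator -/

section Main

open Filter

variable {H : Type u} [NormedAddCommGroup H] [InnerProductSpace ℂ H] [CompleteSpace H]
variable {T : (H →L[ℂ] H) →ₗ[ℂ] (H →L[ℂ] H)} {x y : H →L[ℂ] H}

/-- A limit of averages of a compact operator `x` is submajorized by `x`. -/
theorem IsDunfordSchwartz.submajorized_of_tendsto_average (hT : IsDunfordSchwartz T)
    (hx : IsCompactOperator x) (hy : IsCompactOperator y)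
    (hlim : Tendsto (fun n => average T n x) atTop (𝓝 y)) : Submajorized y x := by
  obtain ⟨ι, φ, hφ⟩ := exists_isSingularBasis hx
  obtain ⟨κ, ψ, hψ⟩ := exists_isSingularBasis hy
  refine submajorized_of_forall_sum_le hx hy hφ hψ fun l hl F G hF hG => ?_
  set B := ∑ i ∈ F, (‖x (φ i)‖ - l) + G.card * l with hB
  have hG0 : ∀ j ∈ G, y (ψ j) ≠ 0 := fun j hj h0 => by
    have := (hG j).mp hj
    rw [h0, norm_zero] at this
    linarith
  -- The bound `B` does not depend on `k`, since every power of `T` is Dunford-Schwartz; it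
  -- therefore survives averaging and the limit.
  have hpow : ∀ k, ∑ j ∈ G, ‖⟪leftVec ψ y j, (T ^ k) x (ψ j)⟫_ℂ‖ ≤ B := by
    classical
    intro k
    have h1 := (hT.pow k).sum_norm_inner_le hφ hl.le
      (fun i hi => not_lt.mp (mt (hF i).mpr hi)) hψ.orthonormal_leftVec
      (ψ.orthonormal.comp _ Subtype.val_injective) (G.subtype fun j => y (ψ j) ≠ 0)
    simp only [Function.comp_apply] at h1
    rw [Finset.sum_subtype_of_mem (fun j => ‖⟪leftVec ψ y j, (T ^ k) x (ψ j)⟫_ℂ‖) hG0,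
      Finset.card_subtype, Finset.filter_true_of_mem hG0] at h1
    refine h1.trans_eq ?_
    rw [hB]
    congr 1
    exact Finset.sum_congr rfl fun i hi => max_eq_left (sub_pos.mpr ((hF i).mp hi)).le
  have havg : ∀ n, ∑ j ∈ G, ‖⟪leftVec ψ y j, average T n x (ψ j)⟫_ℂ‖ ≤ B := by
    intro n
    calc ∑ j ∈ G, ‖⟪leftVec ψ y j, average T n x (ψ j)⟫_ℂ‖
        ≤ ∑ j ∈ G, ((n : ℝ) + 1)⁻¹ * ∑ k ∈ Finset.range (n + 1),
            ‖⟪leftVec ψ y j, (T ^ k) x (ψ j)⟫_ℂ‖ := by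
          refine Finset.sum_le_sum fun j _ => ?_
          rw [average, smul_apply, sum_apply, inner_smul_right, inner_sum, norm_mul,
            norm_natCast_add_one_inv]
          exact mul_le_mul_of_nonneg_left (norm_sum_le _ _) (by positivity)
      _ = ((n : ℝ) + 1)⁻¹ * ∑ k ∈ Finset.range (n + 1), ∑ j ∈ G,
            ‖⟪leftVec ψ y j, (T ^ k) x (ψ j)⟫_ℂ‖ := by
          rw [← Finset.mul_sum, Finset.sum_comm]
      _ ≤ B := by
          rw [inv_mul_le_iff₀ (by positivity)]
          refine (Finset.sum_le_sum fun k _ => hpow k).trans_eq ?_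
          simp
  have h1 : Tendsto (fun n => ∑ j ∈ G, ‖⟪leftVec ψ y j, average T n x (ψ j)⟫_ℂ‖) atTop
      (𝓝 (∑ j ∈ G, ‖⟪leftVec ψ y j, y (ψ j)⟫_ℂ‖)) := by
    refine tendsto_finsetSum _ fun j _ => ?_
    have h2 : Tendsto (fun n => average T n x (ψ j)) atTop (𝓝 (y (ψ j))) :=
      ((ContinuousLinearMap.apply ℂ H (ψ j)).continuous.tendsto y).comp hlim
    exact (((innerSL ℂ (leftVec ψ y j)).continuous.tendsto _).comp h2).norm
  -- In the limit the coefficients along `leftVec ψ y j` are the singular values of `y`; moving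
  -- `G.card * l` to the left gives the claim.
  have h2 := le_of_tendsto h1 (Eventually.of_forall havg)
  simp only [inner_leftVec_self, Complex.norm_real, norm_norm] at h2
  rw [Finset.sum_sub_distrib, Finset.sum_const, nsmul_eq_mul]
  linarith

theorem IsFullySymmetric.satisfiesIET {X : Submodule ℂ (H →L[ℂ] H)} {N : Seminorm ℂ X}
    (hX : IsFullySymmetric X N) (hK : ∀ x ∈ X, IsCompactOperator x) : SatisfiesIET X := by
  intro x hx T hT
  obtain ⟨y, hy, hlim⟩ := hT.exists_tendsto_average (hK x hx)
  obtain ⟨hyX, -⟩ := hX.submajorized ⟨x, hx⟩ y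
    (hT.submajorized_of_tendsto_average (hK x hx) hy hlim)
  exact ⟨y, hyX, tendsto_iff_norm_sub_tendsto_zero.mp hlim⟩

end Main

end SymmOp

end

theorem theorem3p7 {H : Type*} [NormedAddCommGroup H] [InnerProductSpace ℂ H] [CompleteSpace H]
    (hH : ¬ FiniteDimensional ℂ H)
    (X : Submodule ℂ (H →L[ℂ] H)) (N : Seminorm ℂ X) (hX : SymmOp.IsFullySymmetric X N) :
    SymmOp.SatisfiesIET X ↔ ∀ x ∈ X, IsCompactOperator x :=
  ⟨fun h _ hx => h.isCompactOperator hx, fun h => hX.satisfiesIET h⟩
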